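/- Let $(\mathbb{B},\|\cdot\|)$ be a separable real Banach space that is $r$-smooth for some $r\in(1,2]$, i.e. there is an equivalent norm $\|\cdot\|'$ on $\mathbb{B}$ with $$\sup_{\tau>0}\ \sup_{\|x\|'=\|y\|'=1}\frac{\|x+\tau y\|'+\|x-\tau y\|'-2}{\tau^{r}}<\infty .$$ Let $m\ge 1$ be an integer, $p\in(1,r]$ and $q>0$. Then there is a finite constant $K=K(m,p,q,\mathbb{B})$, depending only on $m,p,q$ and $\mathbb{B}$, such that the following holds. Let $(\xi_i)_{i\ge1}$ be an i.i.d. sequence with values in a measurable space $(S,\mathcal{S})$. Write $[m]=\{1,\dots,m\}$, $\xi_J=(\xi_j)_{j\in J}$ for $J\subseteq[m]$, $\operatorname{Inc}^m=\{\mathbf{i}=(i_1,\dots,i_m)\in\mathbb{N}^m: 1\le i_1<\dots<i_m\}$, $\operatorname{Inc}^m_n=\{\mathbf{i}\in\operatorname{Inc}^m: i_m\le n\}$ and $\xi_{\mathbf{i}}=(\xi_{i_1},\dots,\xi_{i_m})$. For each $\mathbf{i}\in\operatorname{Inc}^m$ let $h_{\mathbf{i}}\colon S^m\to\mathbb{B}$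 be a measurable function that is degenerated with respect to $(\xi_i)$, i.e. $h_{\mathbf{i}}(\xi_{[m]})$ is integrable and $\mathbb{E}[h_{\mathbf{i}}(\xi_{[m]})\mid\xi_{[m]\setminus\{\ell_0\}}]=0$ almost surely for every $\ell_0\in[m]$. Then for every integer $N\ge m$ and every $t>0$, $$\begin{aligned} \mathbb{P}\Big(\max_{m\le n\le N}\Big\|\sum_{\mathbf{i}\in\operatorname{Inc}^m_n}h_{\mathbf{i}}(\xi_{\mathbf{i}})\Big\|>t\Big) \le{}& K\sum_{\mathbf{i}\in\operatorname{Inc}^m_N}\int_0^1u^{q-1}\,\mathbb{P}\big(\|h_{\mathbf{i}}(\xi_{[m]})\|>tu\big)\,du\\ &+K\sum_{\emptyset\subsetneq J\subsetneq[m]}\ \sum_{\mathbf{a}\in\mathbb{N}^J}\int_0^1u^{q-1}\,\mathbb{P}\Big(\Big(\sum_{\substack{\mathbf{i}\in\operatorname{Inc}^m_N\\ i_j=a_j\ \forall j\in J}}\mathbb{E}\big[\|h_{\mathbf{i}}(\xi_{[m]})\|^p\mid\xi_J\big]\Big)^{1/p}>tu\Big)\,du\\ &+K\,t^{-q}\Big(\sum_{\mathbf{i}\in\operatorname{Inc}^m_N}\mathbb{E}\|h_{\mathbf{i}}(\xi_{[m]})\|^p\Big)^{q/p},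 \end{aligned}$$ where the right-hand side may be $+\infty$. -/

import Mathlib

/-!
In an equivalent norm `ψ`, an `r`-smooth space satisfies a two-point inequality
`ψ(x + y)^p + ψ(x - y)^p ≤ 2 ψ(x)^p + C ψ(y)^p`, whence the `p`-th moment of a martingale is at
most a constant times the sum of the `p`-th moments of its increments. Applied between two
crossing times, this yields a good-λ inequality, which compares the maximum of the martingale with
its increments and its predictable variation; integrated over `λ`, it bounds the expectation of
`min(1, maximum^p)^κ`, where `κ = q / p`.

The partial sums of a `U`-statistic of order `m` form a martingale whose `k`-th increment collects
the terms with largest index `k`. Conditionally on the `k`-th variable, this increment is a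
`U`-statistic of order `m - 1`. So is the predictable variation, if the resampled variable and its
index are adjoined to a parameter over which the kernels are integrated; for this reason all
estimates are for functions that depend on such a parameter as well. By induction on `m`, the
maximum is controlled by the conditional `p`-th moments given the variables at the positions in
`J`, where `J` runs over all subsets of `[m]`. The full set `J = [m]` gives the first term of the
bound, the proper nonempty ones give the second, and `J = ∅` gives the third.
-/

open MeasureTheory ProbabilityTheory
open scoped ENNReal NNReal

universe u v w

namespace UStat

/-- `B` is `r`-smooth: some equivalent norm `ν` on `B` satisfies
`sup_{τ > 0} sup_{ν x = ν y = 1} (ν (x + τ y) + ν (x - τ y) - 2) / τ ^ r < ∞`.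
A seminorm that is bounded below by a positive multiple of the norm is a norm. -/
def IsSmoothSpace (r : ℝ) (B : Type*) [NormedAddCommGroup B] [NormedSpace ℝ B] : Prop :=
  ∃ ν : Seminorm ℝ B,
    (∃ c C : ℝ, 0 < c ∧ 0 < C ∧ ∀ x : B, c * ‖x‖ ≤ ν x ∧ ν x ≤ C * ‖x‖) ∧
    ∃ L : ℝ, ∀ τ : ℝ, 0 < τ → ∀ x y : B, ν x = 1 → ν y = 1 →
      (ν (x + τ • y) + ν (x - τ • y) - 2) / τ ^ r ≤ L

/-- The set `Inc_n^m` of strictly increasing `m`-tuples of indices. Indices are counted from `0`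
instead of `1`, so that they range over `{0, …, n - 1}`. -/
noncomputable def inc (m n : ℕ) : Finset (Fin m → ℕ) :=
  open Classical in (Fintype.piFinset fun _ : Fin m => Finset.range n).filter StrictMono

/-- The random vector of the first `m` terms of the sequence `ξ`. -/
def firstTerms {Ω S : Type*} (m : ℕ) (ξ : ℕ → Ω → S) : Ω → Fin m → S :=
  fun ω ℓ => ξ ℓ ω

/-- The `σ`-algebra generated by `ξ_J`, the coordinates in `J` of the first `m` terms. -/
abbrev sigmaAlg {Ω S : Type*} [MeasurableSpace S] {m : ℕ} (ξ : ℕ → Ω → S) (J : Finset (Fin m)) :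
    MeasurableSpace Ω :=
  MeasurableSpace.comap (fun ω (j : J) => firstTerms m ξ ω j) inferInstance

/-- Independent and identically distributed sequence of random variables. -/
structure IsIID {Ω S : Type*} [MeasurableSpace Ω] [MeasurableSpace S] (ξ : ℕ → Ω → S)
    (P : Measure Ω) : Prop where
  measurable : ∀ i, Measurable (ξ i)
  indep : iIndepFun ξ P
  identDistrib : ∀ i, IdentDistrib (ξ i) (ξ 0) P P

/-- The kernel `g : S^m → B` is degenerated with respect to `ξ`: the conditional expectation of
`g(ξ_{1,…,m})` given all coordinates but one exists and vanishes, whichever coordinate is left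
out. Integrability is part of the notion, for the conditional expectation to make sense. -/
structure IsDegenerate {Ω S B : Type*} [MeasurableSpace Ω] [MeasurableSpace S]
    [NormedAddCommGroup B] [NormedSpace ℝ B] [CompleteSpace B] {m : ℕ}
    (g : (Fin m → S) → B) (ξ : ℕ → Ω → S) (P : Measure Ω) : Prop where
  integrable : Integrable (fun ω => g (firstTerms m ξ ω)) P
  condExp_eq_zero : ∀ ℓ₀ : Fin m,
    P[fun ω => g (firstTerms m ξ ω) | sigmaAlg ξ (Finset.univ.erase ℓ₀)] =ᵐ[P] 0

/-- The `U`-statistic `∑_{i ∈ Inc_n^m} h_i(ξ_i)`, where `ξ_i = (ξ_{i_1}, …, ξ_{i_m})`. -/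
noncomputable def uStat {Ω S B : Type*} [NormedAddCommGroup B] {m : ℕ}
    (h : (Fin m → ℕ) → (Fin m → S) → B) (ξ : ℕ → Ω → S) (n : ℕ) (ω : Ω) : B :=
  ∑ i ∈ inc m n, h i (fun ℓ => ξ (i ℓ) ω)

/-- `∫_0^1 u^{q-1} P(Y > t u) du` for a `[0, ∞]`-valued random variable `Y`. -/
noncomputable def tailIntegral {Ω : Type*} [MeasurableSpace Ω] (P : Measure Ω) (q t : ℝ)
    (Y : Ω → ℝ≥0∞) : ℝ≥0∞ :=
  ∫⁻ u in Set.Ioo (0 : ℝ) 1, ENNReal.ofReal (u ^ (q - 1)) * P {ω | ENNReal.ofReal (t * u) < Y ω}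

/-- The `p`-th root of the sum of `E[‖h_i(ξ_{1,…,m})‖^p | ξ_J]` over all `i ∈ Inc_N^m` whose
coordinates in `J` are given by `a`. -/
noncomputable def condMomentRoot {Ω S B : Type*} [MeasurableSpace Ω] [MeasurableSpace S]
    [NormedAddCommGroup B] {m : ℕ} (P : Measure Ω) (h : (Fin m → ℕ) → (Fin m → S) → B)
    (ξ : ℕ → Ω → S) (p : ℝ) (N : ℕ) (J : Finset (Fin m)) (a : J → ℕ) (ω : Ω) : ℝ≥0∞ :=
  (∑ i ∈ inc m N with ∀ j : J, i j = a j,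
    condLExp (sigmaAlg ξ J) P (fun ω' => ‖h i (firstTerms m ξ ω')‖ₑ ^ p) ω) ^ (1 / p)

end UStat

namespace UStat

open Finset Function

/-! ### Smooth norms -/

section Smooth

theorem one_add_rpow_le {p s : ℝ} (hp1 : 1 < p) (hp2 : p ≤ 2) (hs : -1 ≤ s) :
    (1 + s) ^ p ≤ 1 + p * s + s ^ 2 := by
  have h0 : 0 ≤ 1 + s := by linarith
  have bernoulli : (1 + s) ^ (p - 1) ≤ 1 + (p - 1) * s :=
    rpow_one_add_le_one_add_mul_self hs (by linarith) (by linarith)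
  calc (1 + s) ^ p = (1 + s) ^ (p - 1) * (1 + s) := by
        rw [← Real.rpow_add_one' h0 (by linarith), sub_add_cancel]
    _ ≤ (1 + (p - 1) * s) * (1 + s) := by gcongr
    _ ≤ 1 + p * s + s ^ 2 := by nlinarith [sq_nonneg s]

theorem rpow_add_rpow_le_of_le_one {p a b τ L : ℝ} (hp1 : 1 < p) (hp2 : p ≤ 2) (hτ : 0 < τ)
    (hτ1 : τ ≤ 1) (ha : |a - 1| ≤ τ) (hb : |b - 1| ≤ τ) (hL : 0 ≤ L)
    (hab : a + b - 2 ≤ L * τ ^ p) :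
    a ^ p + b ^ p ≤ 2 + (2 * L + 2) * τ ^ p := by
  have hτp : τ ^ 2 ≤ τ ^ p := by
    rw [← Real.rpow_two]
    exact Real.rpow_le_rpow_of_exponent_ge hτ hτ1 hp2
  have taylor : ∀ {c : ℝ}, |c - 1| ≤ τ → c ^ p ≤ 1 + p * (c - 1) + τ ^ p := by
    intro c hc
    have h := one_add_rpow_le hp1 hp2 (s := c - 1) (by linarith [(abs_le.1 hc).1])
    rw [add_sub_cancel] at h
    linarith [sq_le_sq' (abs_le.1 hc).1 (abs_le.1 hc).2]
  have linear : p * (a + b - 2) ≤ 2 * (L * τ ^ p) :=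
    calc p * (a + b - 2) ≤ p * (L * τ ^ p) := by gcongr
      _ ≤ 2 * (L * τ ^ p) := by gcongr
  linarith [taylor ha, taylor hb]

theorem rpow_add_rpow_le_of_one_le {p a b τ : ℝ} (hp0 : 0 ≤ p) (hp2 : p ≤ 2) (ha0 : 0 ≤ a)
    (hb0 : 0 ≤ b) (hτ1 : 1 ≤ τ) (ha : |a - 1| ≤ τ) (hb : |b - 1| ≤ τ) :
    a ^ p + b ^ p ≤ 8 * τ ^ p := by
  have hτ : 0 ≤ τ := by linarith
  have bound : ∀ {c : ℝ}, 0 ≤ c → |c - 1| ≤ τ → c ^ p ≤ 4 * τ ^ p := by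
    intro c hc0 hc
    calc c ^ p ≤ (2 * τ) ^ p := by gcongr; linarith [(abs_le.1 hc).2]
      _ = 2 ^ p * τ ^ p := Real.mul_rpow (by norm_num) hτ
      _ ≤ 2 ^ (2 : ℝ) * τ ^ p := by gcongr; norm_num
      _ = 4 * τ ^ p := by norm_num
  linarith [bound ha0 ha, bound hb0 hb]

variable {B : Type*} [NormedAddCommGroup B] [NormedSpace ℝ B]

theorem two_point_of_unit_sphere {ψ : Seminorm ℝ B} {p M : ℝ} (hp : 0 < p) (hM : 2 ≤ M)
    (h : ∀ τ : ℝ, 0 < τ → ∀ x y, ψ x = 1 → ψ y = 1 →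
      ψ (x + τ • y) ^ p + ψ (x - τ • y) ^ p ≤ 2 + M * τ ^ p) (x y : B) :
    ψ (x + y) ^ p + ψ (x - y) ^ p ≤ 2 * ψ x ^ p + M * ψ y ^ p := by
  have triangle : ψ (x + y) ^ p + ψ (x - y) ^ p ≤ 2 * (ψ x + ψ y) ^ p := by
    rw [two_mul]
    gcongr
    exacts [map_add_le_add ψ x y, map_sub_le_add ψ x y]
  rcases (apply_nonneg ψ x).eq_or_lt with hx | hx
  · rw [← hx, zero_add] at triangle
    rw [← hx, Real.zero_rpow hp.ne', mul_zero, zero_add]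
    exact triangle.trans (by gcongr)
  rcases (apply_nonneg ψ y).eq_or_lt with hy | hy
  · rw [← hy, add_zero] at triangle
    rwa [← hy, Real.zero_rpow hp.ne', mul_zero, add_zero]
  have normalized : ∀ {z : B}, 0 < ψ z → ψ ((ψ z)⁻¹ • z) = 1 := fun {z} hz => by
    rw [map_smul_eq_mul, norm_inv, Real.norm_of_nonneg hz.le, inv_mul_cancel₀ hz.ne']
  set τ := ψ y / ψ x
  have hτ : ψ x * τ = ψ y := mul_div_cancel₀ _ hx.ne'
  have hτ0 : 0 < τ := div_pos hy hx
  have hy' : ψ x • τ • (ψ y)⁻¹ • y = y := by rw [smul_smul, hτ, smul_inv_smul₀ hy.ne']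
  have rescale : ∀ z : B, ψ (ψ x • z) ^ p = ψ x ^ p * ψ z ^ p := fun z => by
    rw [map_smul_eq_mul, Real.norm_of_nonneg hx.le, Real.mul_rpow hx.le (apply_nonneg ψ z)]
  calc ψ (x + y) ^ p + ψ (x - y) ^ p
      = ψ x ^ p * (ψ ((ψ x)⁻¹ • x + τ • (ψ y)⁻¹ • y) ^ p +
          ψ ((ψ x)⁻¹ • x - τ • (ψ y)⁻¹ • y) ^ p) := by
        rw [mul_add, ← rescale, ← rescale, smul_add, smul_sub, smul_inv_smul₀ hx.ne', hy']
    _ ≤ ψ x ^ p * (2 + M * τ ^ p) := by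
        gcongr ?_ * ?_
        exact h τ hτ0 _ _ (normalized hx) (normalized hy)
    _ = 2 * ψ x ^ p + M * ψ y ^ p := by
        rw [← hτ, Real.mul_rpow hx.le hτ0.le]
        ring

/-- The seminorm `ψ` is an equivalent norm that satisfies a two-point inequality of power
type `p`; a single constant `C` serves for all three bounds. -/
structure IsTwoPointNorm (p : ℝ) (ψ : Seminorm ℝ B) (C : ℝ≥0) : Prop where
  norm_le : ∀ x, ‖x‖ ≤ C * ψ x
  le_norm : ∀ x, ψ x ≤ C * ‖x‖
  two_point : ∀ x y, ψ (x + y) ^ p + ψ (x - y) ^ p ≤ 2 * ψ x ^ p + C * ψ y ^ p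

theorem two_point_of_modulus_le {ψ : Seminorm ℝ B} {r p L : ℝ} (hr : r ≤ 2)
    (hp : p ∈ Set.Ioc 1 r) (hL0 : 0 ≤ L)
    (hL : ∀ τ : ℝ, 0 < τ → ∀ x y, ψ x = 1 → ψ y = 1 →
      (ψ (x + τ • y) + ψ (x - τ • y) - 2) / τ ^ r ≤ L) (x y : B) :
    ψ (x + y) ^ p + ψ (x - y) ^ p ≤ 2 * ψ x ^ p + (2 * L + 8) * ψ y ^ p := by
  have hp2 : p ≤ 2 := hp.2.trans hr
  have hp0 : 0 < p := one_pos.trans hp.1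
  refine two_point_of_unit_sphere hp0 (by linarith) (fun τ hτ x y hx hy => ?_) x y
  have hτp : 0 ≤ τ ^ p := by positivity
  have hτy : ψ (τ • y) = τ := by rw [map_smul_eq_mul, hy, mul_one, Real.norm_of_nonneg hτ.le]
  have hadd : |ψ (x + τ • y) - 1| ≤ τ := by
    simpa only [hx, add_sub_cancel_left, hτy] using abs_sub_map_le_sub ψ (x + τ • y) x
  have hsub : |ψ (x - τ • y) - 1| ≤ τ := by
    simpa only [hx, sub_sub_cancel_left, map_neg_eq_map, hτy] using
      abs_sub_map_le_sub ψ (x - τ • y) x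
  rcases le_total τ 1 with hτ1 | hτ1
  · have modulus : ψ (x + τ • y) + ψ (x - τ • y) - 2 ≤ L * τ ^ p :=
      calc _ ≤ L * τ ^ r := (div_le_iff₀ (by positivity)).1 (hL τ hτ x y hx hy)
        _ ≤ L * τ ^ p := by gcongr ?_ * ?_; exact Real.rpow_le_rpow_of_exponent_ge hτ hτ1 hp.2
    linarith [rpow_add_rpow_le_of_le_one hp.1 hp2 hτ hτ1 hadd hsub hL0 modulus]
  · have := rpow_add_rpow_le_of_one_le hp0.le hp2 (apply_nonneg ψ _) (apply_nonneg ψ _) hτ1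
      hadd hsub
    nlinarith [mul_nonneg hL0 hτp]

theorem IsSmoothSpace.exists_isTwoPointNorm {r p : ℝ} (hB : IsSmoothSpace r B) (hr : r ≤ 2)
    (hp : p ∈ Set.Ioc 1 r) : ∃ (ψ : Seminorm ℝ B) (C : ℝ≥0), IsTwoPointNorm p ψ C := by
  obtain ⟨ψ, ⟨c, C, hc, _, hcC⟩, L, hL⟩ := hB
  have two_point := two_point_of_modulus_le hr hp (le_max_right L 0)
    fun τ hτ x y hx hy => (hL τ hτ x y hx hy).trans (le_max_left L 0)
  set D := max (max c⁻¹ C) (2 * max L 0 + 8)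
  have hD : 0 ≤ D := by positivity
  refine ⟨ψ, D.toNNReal, fun x => ?_, fun x => ?_, fun x y => ?_⟩ <;>
    rw [Real.coe_toNNReal _ hD]
  · calc ‖x‖ ≤ c⁻¹ * ψ x := (le_inv_mul_iff₀ hc).2 (hcC x).1
      _ ≤ _ := by gcongr; exact (le_max_left _ _).trans (le_max_left _ _)
  · calc ψ x ≤ C * ‖x‖ := (hcC x).2
      _ ≤ _ := by gcongr; exact (le_max_right _ _).trans (le_max_left _ _)
  · calc _ ≤ 2 * ψ x ^ p + (2 * max L 0 + 8) * ψ y ^ p := two_point x y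
      _ ≤ _ := by gcongr; exact le_max_right _ _

namespace IsTwoPointNorm

variable {p : ℝ} {ψ : Seminorm ℝ B} {C : ℝ≥0}

theorem continuous (hψ : IsTwoPointNorm p ψ C) : Continuous ψ :=
  Seminorm.continuous_of_le (q := C • normSeminorm ℝ B)
    (show Continuous fun x : B => (C : ℝ) * ‖x‖ by fun_prop) hψ.le_norm

theorem ofReal_rpow_le (hψ : IsTwoPointNorm p ψ C) (hp : 0 ≤ p) (x : B) :
    ENNReal.ofReal (ψ x ^ p) ≤ (C : ℝ≥0∞) ^ p * ‖x‖ₑ ^ p := by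
  rw [← ENNReal.mul_rpow_of_nonneg _ _ hp, ← ofReal_norm, ← ENNReal.ofReal_coe_nnreal,
    ← ENNReal.ofReal_mul C.coe_nonneg, ENNReal.ofReal_rpow_of_nonneg (by positivity) hp]
  exact ENNReal.ofReal_le_ofReal (Real.rpow_le_rpow (apply_nonneg ψ x) (hψ.le_norm x) hp)

theorem enorm_rpow_le (hψ : IsTwoPointNorm p ψ C) (hp : 0 ≤ p) (x : B) :
    ‖x‖ₑ ^ p ≤ (C : ℝ≥0∞) ^ p * ENNReal.ofReal (ψ x ^ p) := by
  rw [← ENNReal.ofReal_rpow_of_nonneg (apply_nonneg ψ x) hp, ← ENNReal.mul_rpow_of_nonneg _ _ hp,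
    ← ofReal_norm, ← ENNReal.ofReal_coe_nnreal, ← ENNReal.ofReal_mul C.coe_nonneg]
  exact ENNReal.rpow_le_rpow (ENNReal.ofReal_le_ofReal (hψ.norm_le x)) hp

theorem ofReal_two_point (hψ : IsTwoPointNorm p ψ C) (x y : B) :
    ENNReal.ofReal (ψ (x + y) ^ p) + ENNReal.ofReal (ψ (x - y) ^ p) ≤
      2 * ENNReal.ofReal (ψ x ^ p) + C * ENNReal.ofReal (ψ y ^ p) := by
  rw [← ENNReal.ofReal_ofNat, ← ENNReal.ofReal_coe_nnreal, ← ENNReal.ofReal_mul (by positivity),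
    ← ENNReal.ofReal_mul (by positivity), ← ENNReal.ofReal_add (by positivity) (by positivity),
    ← ENNReal.ofReal_add (by positivity) (by positivity)]
  exact ENNReal.ofReal_le_ofReal (hψ.two_point x y)

end IsTwoPointNorm

theorem convexOn_seminorm_rpow (ψ : Seminorm ℝ B) {p : ℝ} (hp : 1 ≤ p) :
    ConvexOn ℝ Set.univ fun x => ψ x ^ p := by
  refine ⟨convex_univ, fun x hx y hy a b ha hb hab => ?_⟩
  calc ψ (a • x + b • y) ^ p ≤ (a • ψ x + b • ψ y) ^ p := by
        gcongr
        exact ψ.convexOn.2 hx hy ha hb hab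
    _ ≤ a • ψ x ^ p + b • ψ y ^ p :=
        (convexOn_rpow hp).2 (apply_nonneg ψ x) (apply_nonneg ψ y) ha hb hab

theorem ofReal_seminorm_rpow_le_lintegral {Ω : Type*} [CompleteSpace B] [MeasurableSpace Ω]
    {P : Measure Ω} [IsProbabilityMeasure P] {ψ : Seminorm ℝ B} (hψ : Continuous ψ) {p : ℝ}
    (hp : 1 ≤ p) {g : Ω → B} (hg : Integrable g P) (hg0 : ∫ ω, g ω ∂P = 0) (a : B) :
    ENNReal.ofReal (ψ a ^ p) ≤ ∫⁻ ω, ENNReal.ofReal (ψ (a - g ω) ^ p) ∂P := by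
  have hcont : Continuous fun x => ψ x ^ p := hψ.rpow_const fun x => Or.inr (by linarith)
  have hag : Integrable (fun ω => a - g ω) P := (integrable_const a).sub hg
  have hnonneg : 0 ≤ᵐ[P] fun ω => ψ (a - g ω) ^ p := ae_of_all _ fun ω => by positivity
  by_cases htop : ∫⁻ ω, ENNReal.ofReal (ψ (a - g ω) ^ p) ∂P = ∞
  · exact htop ▸ le_top
  have hint : Integrable (fun ω => ψ (a - g ω) ^ p) P :=
    ⟨hcont.comp_aestronglyMeasurable hag.1,
      (hasFiniteIntegral_iff_ofReal hnonneg).2 (lt_top_iff_ne_top.2 htop)⟩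
  have hmean : ∫ ω, a - g ω ∂P = a := by
    rw [integral_sub (integrable_const a) hg, hg0, sub_zero, integral_const, probReal_univ,
      one_smul]
  rw [← ofReal_integral_eq_lintegral_ofReal hint hnonneg]
  refine ENNReal.ofReal_le_ofReal ?_
  simpa only [hmean] using (convexOn_seminorm_rpow ψ hp).map_integral_le hcont.continuousOn
    isClosed_univ (ae_of_all _ fun _ => Set.mem_univ _) hag hint

end Smooth

/-! ### Truncated powers and tail integrals -/

/-- The truncated power `min(1, w) ^ κ`. Its expectations are the tail integrals, see
`lintegral_truncRpow`. -/
noncomputable def truncRpow (κ : ℝ) (w : ℝ≥0∞) : ℝ≥0∞ := (min 1 w) ^ κ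

section TruncRpow

variable {κ : ℝ}

theorem truncRpow_le_one (hκ : 0 ≤ κ) (w : ℝ≥0∞) : truncRpow κ w ≤ 1 :=
  ENNReal.rpow_le_one (min_le_left _ _) hκ

theorem truncRpow_of_one_le {w : ℝ≥0∞} (hw : 1 ≤ w) : truncRpow κ w = 1 := by
  rw [truncRpow, min_eq_left hw, ENNReal.one_rpow]

theorem truncRpow_zero (hκ : 0 < κ) : truncRpow κ 0 = 0 := by
  rw [truncRpow, min_eq_right zero_le_one, ENNReal.zero_rpow_of_pos hκ]

theorem truncRpow_mono (hκ : 0 ≤ κ) : Monotone (truncRpow κ) := fun _ _ h =>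
  ENNReal.rpow_le_rpow (min_le_min_left _ h) hκ

theorem truncRpow_le_rpow (hκ : 0 ≤ κ) (w : ℝ≥0∞) : truncRpow κ w ≤ w ^ κ :=
  ENNReal.rpow_le_rpow (min_le_right _ _) hκ

@[fun_prop]
theorem measurable_truncRpow {Z : Type*} [MeasurableSpace Z] {f : Z → ℝ≥0∞} (hf : Measurable f) :
    Measurable fun z => truncRpow κ (f z) :=
  (measurable_const.min hf).pow_const κ

theorem truncRpow_mul_le (hκ : 0 ≤ κ) {c : ℝ≥0∞} (hc : 1 ≤ c) (w : ℝ≥0∞) :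
    truncRpow κ (c * w) ≤ c ^ κ * truncRpow κ w := by
  rw [truncRpow, truncRpow, ← ENNReal.mul_rpow_of_nonneg _ _ hκ]
  refine ENNReal.rpow_le_rpow ?_ hκ
  rw [mul_min, mul_one]
  exact min_le_min_right _ hc

theorem truncRpow_sum_le {ι : Type*} (hκ : 0 < κ) (s : Finset ι) (w : ι → ℝ≥0∞) :
    truncRpow κ (∑ i ∈ s, w i) ≤ (#s : ℝ≥0∞) ^ κ * ∑ i ∈ s, truncRpow κ (w i) := by
  rcases s.eq_empty_or_nonempty with rfl | hs
  · rw [sum_empty, truncRpow_zero hκ]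
    exact zero_le
  obtain ⟨j, hj, hmax⟩ := s.exists_max_image w hs
  have hc : (1 : ℝ≥0∞) ≤ #s := by exact_mod_cast hs.card_pos
  calc truncRpow κ (∑ i ∈ s, w i) ≤ truncRpow κ (#s * w j) := by
        rw [← nsmul_eq_mul]
        exact truncRpow_mono hκ.le (sum_le_card_nsmul _ _ _ hmax)
    _ ≤ (#s : ℝ≥0∞) ^ κ * truncRpow κ (w j) := truncRpow_mul_le hκ.le hc _
    _ ≤ (#s : ℝ≥0∞) ^ κ * ∑ i ∈ s, truncRpow κ (w i) := by
        gcongr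
        exact single_le_sum (f := fun i => truncRpow κ (w i)) (fun _ _ => zero_le) hj

theorem truncRpow_rpow {p : ℝ} (hp : 0 < p) (w : ℝ≥0∞) :
    truncRpow κ (w ^ p) = truncRpow (p * κ) w := by
  rw [truncRpow, truncRpow, ENNReal.rpow_mul, (ENNReal.monotone_rpow_of_nonneg hp.le).map_min,
    ENNReal.one_rpow]

theorem lintegral_truncRpow {Ω : Type*} [MeasurableSpace Ω] (P : Measure Ω) {q t : ℝ}
    (hq : 0 < q) (ht : 0 < t) {Y : Ω → ℝ≥0∞} (hY : AEMeasurable Y P) :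
    ∫⁻ ω, truncRpow q (Y ω / ENNReal.ofReal t) ∂P = ENNReal.ofReal q * tailIntegral P q t Y := by
  set f : Ω → ℝ := fun ω => (min 1 (Y ω / ENNReal.ofReal t)).toReal
  have hfin : ∀ ω, min 1 (Y ω / ENNReal.ofReal t) ≠ ∞ := fun ω =>
    ne_top_of_le_ne_top ENNReal.one_ne_top (min_le_left _ _)
  have hf : AEMeasurable f P := (aemeasurable_const.min (hY.div_const _)).ennreal_toReal
  have lt_iff : ∀ u : ℝ, 0 < u → ∀ ω, u < f ω ↔ u < 1 ∧ ENNReal.ofReal (t * u) < Y ω := by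
    intro u hu ω
    rw [← ENNReal.ofReal_lt_iff_lt_toReal hu.le (hfin ω), lt_min_iff, ENNReal.ofReal_lt_one,
      ENNReal.lt_div_iff_mul_lt (.inl (by simpa using ht)) (.inl ENNReal.ofReal_ne_top),
      ← ENNReal.ofReal_mul hu.le, mul_comm u t]
  calc ∫⁻ ω, truncRpow q (Y ω / ENNReal.ofReal t) ∂P = ∫⁻ ω, ENNReal.ofReal (f ω ^ q) ∂P := by
        simp only [truncRpow, f, ← ENNReal.ofReal_rpow_of_nonneg ENNReal.toReal_nonneg hq.le,
          ENNReal.ofReal_toReal (hfin _)]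
    _ = ENNReal.ofReal q * ∫⁻ u in Set.Ioi 0, P {ω | u < f ω} * ENNReal.ofReal (u ^ (q - 1)) :=
        lintegral_rpow_eq_lintegral_meas_lt_mul P (ae_of_all _ fun ω => ENNReal.toReal_nonneg)
          hf hq
    _ = ENNReal.ofReal q * tailIntegral P q t Y := by
        rw [tailIntegral, ← lintegral_indicator measurableSet_Ioi,
          ← lintegral_indicator measurableSet_Ioo]
        congr 2 with u
        simp only [Set.indicator_apply, Set.mem_Ioi, Set.mem_Ioo]
        by_cases hu : 0 < u <;> by_cases hu1 : u < 1 <;>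
          simp [hu, hu1, lt_iff, mul_comm]

end TruncRpow

/-! ### Resampling coordinates of product measures -/

/-- The common law of a family of independent variables with law `μ`. -/
noncomputable abbrev iidLaw (ι : Type*) {S : Type*} [MeasurableSpace S] (μ : Measure S) :
    Measure (ι → S) :=
  Measure.infinitePi fun _ : ι => μ

section Resampling

variable {ι S : Type*} [DecidableEq ι] [MeasurableSpace S]

@[fun_prop]
theorem measurable_piecewise_comp {Z : Type*} [MeasurableSpace Z] (A : Finset ι)
    {f g : Z → ι → S} (hf : Measurable f) (hg : Measurable g) :
    Measurable fun z => A.piecewise (f z) (g z) := by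
  refine measurable_pi_iff.2 fun i => ?_
  by_cases hi : i ∈ A
  · simp only [piecewise_eq_of_mem _ _ _ hi]
    fun_prop
  · simp only [piecewise_eq_of_notMem _ _ _ hi]
    fun_prop

@[fun_prop]
theorem measurable_update_comp {Z : Type*} [MeasurableSpace Z] (k : ι) {f : Z → ι → S}
    {g : Z → S} (hf : Measurable f) (hg : Measurable g) :
    Measurable fun z => update (f z) k (g z) :=
  measurable_update'.comp (hf.prodMk hg)

variable (μ : Measure S) [IsProbabilityMeasure μ]

theorem measurePreserving_piecewise (A : Finset ι) :
    MeasurePreserving (fun z : (ι → S) × (ι → S) => A.piecewise z.1 z.2)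
      ((iidLaw ι μ).prod (iidLaw ι μ)) (iidLaw ι μ) := by
  have hm : Measurable fun z : (ι → S) × (ι → S) => A.piecewise z.1 z.2 := by fun_prop
  refine ⟨hm, Measure.eq_infinitePi _ fun s t ht => ?_⟩
  have preimage_box : (fun z : (ι → S) × (ι → S) => A.piecewise z.1 z.2) ⁻¹' Set.pi s t =
      (Set.pi (s.filter (· ∈ A)) t) ×ˢ (Set.pi (s.filter (· ∉ A)) t) := by
    ext z
    simp only [Set.mem_preimage, Set.mem_pi, Set.mem_prod, mem_coe, mem_filter, and_imp,
      ← forall_and]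
    refine forall₂_congr fun i _ => ?_
    by_cases hA : i ∈ A <;> simp [hA]
  rw [Measure.map_apply hm (.pi s.countable_toSet fun i _ => ht i), preimage_box,
    Measure.prod_prod, Measure.infinitePi_pi _ fun i _ => ht i,
    Measure.infinitePi_pi _ fun i _ => ht i, prod_filter_mul_prod_filter_not]

theorem measurePreserving_update (k : ι) :
    MeasurePreserving (fun z : (ι → S) × S => update z.1 k z.2) ((iidLaw ι μ).prod μ)
      (iidLaw ι μ) := by
  have split : MeasurePreserving (fun z : (ι → S) × (ι → S) => (z.2, z.1 k))
      ((iidLaw ι μ).prod (iidLaw ι μ)) ((iidLaw ι μ).prod μ) :=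
    ((MeasurePreserving.id _).prod (measurePreserving_eval_infinitePi _ k)).comp
      Measure.measurePreserving_swap
  rw [← split.map_eq]
  refine MeasurePreserving.map_of_comp ?_ (by fun_prop) split.measurable
  simpa only [comp_def, piecewise_singleton] using measurePreserving_piecewise μ {k}

variable {Y : Type*} [MeasurableSpace Y] (ν : Measure Y) [SFinite ν]

theorem measurePreserving_update_prod (k : ι) :
    MeasurePreserving (fun w : ((ι → S) × Y) × S => (update w.1.1 k w.2, w.1.2))
      (((iidLaw ι μ).prod ν).prod μ) ((iidLaw ι μ).prod ν) := by
  have rearrange : MeasurePreserving (fun w : ((ι → S) × Y) × S => ((w.1.1, w.2), w.1.2))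
      (((iidLaw ι μ).prod ν).prod μ) (((iidLaw ι μ).prod μ).prod ν) :=
    ((measurePreserving_prodAssoc _ μ ν).symm).comp
      (((MeasurePreserving.id _).prod Measure.measurePreserving_swap).comp
        (measurePreserving_prodAssoc _ ν μ))
  exact ((measurePreserving_update μ k).prod (.id ν)).comp rearrange

end Resampling

/-! ### Moments of martingales -/

section Moments

variable {B : Type*} [NormedAddCommGroup B] [MeasurableSpace B] [BorelSpace B]
  {Z : Type*} [MeasurableSpace Z] {Q : Measure Z}
  {S : Type*} [MeasurableSpace S] {μ : Measure S}

/-- The absolute moment `∫ ‖f‖ ^ p dQ`. -/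
noncomputable def pMoment {B : Type*} [NormedAddCommGroup B] (p : ℝ) (Q : Measure Z) (f : Z → B) :
    ℝ≥0∞ :=
  ∫⁻ z, ‖f z‖ₑ ^ p ∂Q

theorem measurable_pMoment [SFinite μ] {p : ℝ} {f : Z → S → B}
    (hf : Measurable fun w : Z × S => f w.1 w.2) : Measurable fun z => pMoment p μ (f z) :=
  Measurable.lintegral_prod_right' (f := fun w : Z × S => ‖f w.1 w.2‖ₑ ^ p) (by fun_prop)

variable [SecondCountableTopology B]

theorem memLp_iff_pMoment_ne_top {p : ℝ} (hp : 0 < p) {g : Z → B} (hg : Measurable g) :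
    MemLp g (ENNReal.ofReal p) Q ↔ pMoment p Q g ≠ ∞ := by
  rw [MemLp, and_iff_right hg.aestronglyMeasurable,
    eLpNorm_lt_top_iff_lintegral_rpow_enorm_lt_top (ENNReal.ofReal_pos.2 hp).ne'
      ENNReal.ofReal_ne_top, ENNReal.toReal_ofReal hp.le, lt_top_iff_ne_top, pMoment]

theorem integrable_of_pMoment_ne_top [IsFiniteMeasure Q] {p : ℝ} (hp : 1 ≤ p) {g : Z → B}
    (hg : Measurable g) (h : pMoment p Q g ≠ ∞) : Integrable g Q :=
  ((memLp_iff_pMoment_ne_top (by linarith) hg).2 h).integrable (ENNReal.one_le_ofReal.2 hp)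

theorem pMoment_sum_ne_top {p : ℝ} (hp : 0 < p) {ι : Type*} {s : Finset ι} {g : ι → Z → B}
    (hg : ∀ i, Measurable (g i)) (h : ∀ i, pMoment p Q (g i) ≠ ∞) :
    pMoment p Q (fun z => ∑ i ∈ s, g i z) ≠ ∞ :=
  (memLp_iff_pMoment_ne_top hp (by fun_prop)).1 <|
    memLp_finsetSum s fun i _ => (memLp_iff_pMoment_ne_top hp (hg i)).2 (h i)

variable [IsProbabilityMeasure μ] {p : ℝ} {ρ : Z × S → Z}

theorem ae_integrable_of_pMoment_ne_top (hp : 1 ≤ p) (hρ : MeasurePreserving ρ (Q.prod μ) Q)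
    {D : Z → B} (hD : Measurable D) (hfin : pMoment p Q D ≠ ∞) :
    ∀ᵐ z ∂Q, Integrable (fun s => D (ρ (z, s))) μ := by
  have hρm := hρ.measurable
  have fubini : ∫⁻ z, pMoment p μ (fun s => D (ρ (z, s))) ∂Q ≠ ∞ := by
    rwa [pMoment, ← hρ.lintegral_comp (by fun_prop), lintegral_prod _ (by fun_prop)] at hfin
  filter_upwards [ae_lt_top (measurable_pMoment (by fun_prop)) fubini] with z hz
  exact integrable_of_pMoment_ne_top hp (by fun_prop) hz.ne

variable [NormedSpace ℝ B] [CompleteSpace B] {ψ : Seminorm ℝ B} {C : ℝ≥0}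

/- By Jensen's inequality a centred increment `D` satisfies `E ψ(T) ^ p ≤ E ψ(T - D) ^ p`, so in
the integrated two-point inequality the term at `T - D` absorbs one of the two copies of
`E ψ(T) ^ p`. -/
theorem lintegral_seminorm_add_rpow_le (hψ : IsTwoPointNorm p ψ C) (hp : 1 ≤ p)
    (hρ : MeasurePreserving ρ (Q.prod μ) Q) {T D : Z → B} (hT : Measurable T) (hD : Measurable D)
    (hTρ : ∀ w, T (ρ w) = T w.1) (hD0 : ∀ᵐ z ∂Q, ∫ s, D (ρ (z, s)) ∂μ = 0)
    (hDfin : pMoment p Q D ≠ ∞) (hTfin : ∫⁻ z, ENNReal.ofReal (ψ (T z) ^ p) ∂Q ≠ ∞) :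
    ∫⁻ z, ENNReal.ofReal (ψ (T z + D z) ^ p) ∂Q ≤
      ∫⁻ z, ENNReal.ofReal (ψ (T z) ^ p) ∂Q + C * ∫⁻ z, ENNReal.ofReal (ψ (D z) ^ p) ∂Q := by
  have hρm := hρ.measurable
  have hψm : Measurable ψ := hψ.continuous.measurable
  have jensen : ∫⁻ z, ENNReal.ofReal (ψ (T z) ^ p) ∂Q ≤
      ∫⁻ z, ENNReal.ofReal (ψ (T z - D z) ^ p) ∂Q := by
    rw [← hρ.lintegral_comp (f := fun z => ENNReal.ofReal (ψ (T z - D z) ^ p)) (by fun_prop),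
      lintegral_prod _ (by fun_prop)]
    refine lintegral_mono_ae ?_
    filter_upwards [hD0, ae_integrable_of_pMoment_ne_top hp hρ hD hDfin] with z hz hi
    simp only [hTρ]
    exact ofReal_seminorm_rpow_le_lintegral hψ.continuous hp hi hz (T z)
  have two_point : ∫⁻ z, ENNReal.ofReal (ψ (T z + D z) ^ p) ∂Q +
      ∫⁻ z, ENNReal.ofReal (ψ (T z - D z) ^ p) ∂Q ≤
      2 * ∫⁻ z, ENNReal.ofReal (ψ (T z) ^ p) ∂Q +
        C * ∫⁻ z, ENNReal.ofReal (ψ (D z) ^ p) ∂Q := by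
    rw [← lintegral_add_right _ (by fun_prop), ← lintegral_const_mul _ (by fun_prop),
      ← lintegral_const_mul _ (by fun_prop), ← lintegral_add_right _ (by fun_prop)]
    exact lintegral_mono fun z => hψ.ofReal_two_point (T z) (D z)
  refine (ENNReal.add_le_add_iff_right hTfin).1 ?_
  calc _ ≤ ∫⁻ z, ENNReal.ofReal (ψ (T z + D z) ^ p) ∂Q +
        ∫⁻ z, ENNReal.ofReal (ψ (T z - D z) ^ p) ∂Q := by gcongr
    _ ≤ _ := two_point
    _ = _ := by ring

end Moments

section MartingaleDiff

variable {B : Type*} [NormedAddCommGroup B] [NormedSpace ℝ B] [MeasurableSpace B]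
  {S : Type*} [MeasurableSpace S] {μ : Measure S} [IsProbabilityMeasure μ]
  {Y : Type*} [MeasurableSpace Y] {ν : Measure Y}

/-- Martingale differences on `(ℕ → S) × Y`, with finite `p`-th moments, for the filtration
generated by the parameter `y : Y` and the first coordinates of the i.i.d. sequence: the increment
`d k` depends on the coordinates `0, …, k` and vanishes on average when the `k`-th coordinate is
resampled. The parameter space need not carry a finite measure. -/
structure IsMartingaleDiff (p : ℝ) (μ : Measure S) [IsProbabilityMeasure μ] (ν : Measure Y)
    (d : ℕ → (ℕ → S) × Y → B) : Prop where
  measurable : ∀ k, Measurable (d k)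
  dependsOn : ∀ k y, DependsOn (fun x => d k (x, y)) (Set.Iic k)
  integral_update : ∀ k, ∀ᵐ z ∂(iidLaw ℕ μ).prod ν, ∫ s, d k (update z.1 k s, z.2) ∂μ = 0
  pMoment_ne_top : ∀ k, pMoment p ((iidLaw ℕ μ).prod ν) (d k) ≠ ∞

variable [BorelSpace B] [SecondCountableTopology B] [CompleteSpace B]
  {p : ℝ} {ψ : Seminorm ℝ B} {C : ℝ≥0} {d : ℕ → (ℕ → S) × Y → B}

theorem IsMartingaleDiff.lintegral_seminorm_sum_rpow_le [SFinite ν]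
    (hd : IsMartingaleDiff p μ ν d) (hψ : IsTwoPointNorm p ψ C) (hp : 1 ≤ p) (n : ℕ) :
    ∫⁻ z, ENNReal.ofReal (ψ (∑ k ∈ range n, d k z) ^ p) ∂(iidLaw ℕ μ).prod ν ≤
      C * (C ^ p * ∑ k ∈ range n, pMoment p ((iidLaw ℕ μ).prod ν) (d k)) := by
  have hp0 : 0 < p := by linarith
  have hdm := hd.measurable
  induction n with
  | zero => simp [Real.zero_rpow hp0.ne']
  | succ n ih =>
    have past_update : ∀ w : ((ℕ → S) × Y) × S,
        ∑ k ∈ range n, d k (update w.1.1 n w.2, w.1.2) = ∑ k ∈ range n, d k w.1 := fun w =>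
      sum_congr rfl fun k hk => hd.dependsOn k w.1.2 fun i hi =>
        update_of_ne ((Set.mem_Iic.1 hi).trans_lt (mem_range.1 hk)).ne _ _
    have past_ne_top := ne_top_of_le_ne_top (ENNReal.mul_ne_top ENNReal.coe_ne_top
      (ENNReal.mul_ne_top (ENNReal.rpow_ne_top_of_nonneg hp0.le ENNReal.coe_ne_top)
        (ENNReal.sum_ne_top.2 fun k _ => hd.pMoment_ne_top k))) ih
    have increment : ∫⁻ z, ENNReal.ofReal (ψ (d n z) ^ p) ∂(iidLaw ℕ μ).prod ν ≤
        C ^ p * pMoment p ((iidLaw ℕ μ).prod ν) (d n) := by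
      rw [pMoment, ← lintegral_const_mul _ (by fun_prop)]
      exact lintegral_mono fun z => hψ.ofReal_rpow_le hp0.le _
    simp only [sum_range_succ]
    calc _ ≤ _ := lintegral_seminorm_add_rpow_le hψ hp (measurePreserving_update_prod μ ν n)
            (by fun_prop) (hdm n) past_update (hd.integral_update n) (hd.pMoment_ne_top n)
            past_ne_top
      _ ≤ C * (C ^ p * ∑ k ∈ range n, pMoment p ((iidLaw ℕ μ).prod ν) (d k)) +
          C * (C ^ p * pMoment p ((iidLaw ℕ μ).prod ν) (d n)) := by gcongr
      _ = _ := by ring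

/-- The constant of the moment inequality `IsMartingaleDiff.pMoment_sum_le` for a two-point norm
of power type `p` with constant `C`. -/
noncomputable def momentConst (p : ℝ) (C : ℝ≥0) : ℝ≥0 := C ^ p * C * C ^ p

theorem IsMartingaleDiff.pMoment_sum_le [SFinite ν] (hd : IsMartingaleDiff p μ ν d)
    (hψ : IsTwoPointNorm p ψ C) (hp : 1 ≤ p) (n : ℕ) :
    pMoment p ((iidLaw ℕ μ).prod ν) (fun z => ∑ k ∈ range n, d k z) ≤
      momentConst p C * ∑ k ∈ range n, pMoment p ((iidLaw ℕ μ).prod ν) (d k) := by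
  have hp0 : 0 ≤ p := by linarith
  have hdm := hd.measurable
  have hψm : Measurable ψ := hψ.continuous.measurable
  calc _ ≤ ∫⁻ z, C ^ p * ENNReal.ofReal (ψ (∑ k ∈ range n, d k z) ^ p) ∂(iidLaw ℕ μ).prod ν :=
        lintegral_mono fun z => hψ.enorm_rpow_le hp0 _
    _ = C ^ p * ∫⁻ z, ENNReal.ofReal (ψ (∑ k ∈ range n, d k z) ^ p) ∂(iidLaw ℕ μ).prod ν :=
        lintegral_const_mul _ (by fun_prop)
    _ ≤ C ^ p * (C * (C ^ p * ∑ k ∈ range n, pMoment p ((iidLaw ℕ μ).prod ν) (d k))) := by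
        gcongr
        exact hd.lintegral_seminorm_sum_rpow_le hψ hp n
    _ = _ := by
        rw [momentConst, ENNReal.coe_mul, ENNReal.coe_mul, ENNReal.coe_rpow_of_nonneg _ hp0]
        ring

end MartingaleDiff

/-! ### A good-λ inequality -/

section PMoment

variable {B : Type*} [NormedAddCommGroup B] {Y : Type*} [MeasurableSpace Y] {ν : Measure Y}
  {p : ℝ}

theorem pMoment_zero (hp : 0 < p) : pMoment p ν (fun _ => (0 : B)) = 0 := by
  simp [pMoment, ENNReal.zero_rpow_of_pos hp]

variable [MeasurableSpace B] [BorelSpace B]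

theorem lintegral_pMoment [SFinite ν] {X : Type*} [MeasurableSpace X] {Q : Measure X}
    {F : X × Y → B} (hF : Measurable F) :
    ∫⁻ x, pMoment p ν (fun y => F (x, y)) ∂Q = pMoment p (Q.prod ν) F :=
  (lintegral_prod (fun z => ‖F z‖ₑ ^ p) (by fun_prop)).symm

theorem pMoment_add_le (hp : 1 ≤ p) {f g : Y → B} (hf : Measurable f) :
    pMoment p ν (fun y => f y + g y) ≤ 2 ^ (p - 1) * (pMoment p ν f + pMoment p ν g) := by
  rw [pMoment, pMoment, pMoment, ← lintegral_add_left (by fun_prop),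
    ← lintegral_const_mul' _ _ (ENNReal.rpow_ne_top_of_nonneg (by linarith) ENNReal.ofNat_ne_top)]
  exact lintegral_mono fun y => (ENNReal.rpow_le_rpow (enorm_add_le _ _) (by linarith)).trans
    (ENNReal.rpow_add_le_mul_rpow_add_rpow _ _ hp)

end PMoment

section Crossing

theorem lt_sup_range_succ_iff {α : Type*} [LinearOrder α] [OrderBot α] {u : ℕ → α} {a : α}
    (h : ∃ n, a < u n) {k : ℕ} : a < (range (k + 1)).sup u ↔ Nat.find h ≤ k := by
  simp only [Finset.lt_sup_iff, mem_range, Nat.lt_succ_iff, Nat.find_le_iff]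

theorem exists_crossing_interval {α : Type*} [LinearOrder α] [OrderBot α] {u : ℕ → α} {a c : α}
    {N : ℕ} (h0 : u 0 ≤ a) (hac : a ≤ c) (hc : c < (range (N + 1)).sup u) :
    ∃ τ σ, τ < σ ∧ σ ≤ N ∧ u τ ≤ a ∧ c < u σ ∧
      ∀ k, a < (range (k + 1)).sup u ∧ (range (k + 1)).sup u ≤ c ↔ k ∈ Ico (τ + 1) σ := by
  have hσ : ∃ n, c < u n := let ⟨n, _, hn⟩ := Finset.lt_sup_iff.1 hc; ⟨n, hn⟩
  have hτ : ∃ n, a < u n := hσ.imp fun _ => hac.trans_lt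
  have find_ne_zero : Nat.find hτ ≠ 0 := fun h => (h ▸ Nat.find_spec hτ).not_ge h0
  obtain ⟨τ, hτ_eq⟩ := Nat.exists_eq_succ_of_ne_zero find_ne_zero
  refine ⟨τ, Nat.find hσ, ?_, (lt_sup_range_succ_iff hσ).1 hc,
    not_lt.1 (Nat.find_min hτ (by omega)), Nat.find_spec hσ, fun k => ?_⟩
  · exact Nat.lt_of_succ_le (hτ_eq ▸ Nat.find_mono fun _ => hac.trans_lt)
  · rw [← not_lt (a := c), lt_sup_range_succ_iff hτ, lt_sup_range_succ_iff hσ, not_le, hτ_eq,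
      mem_Ico]

/-- The ratio of two levels such that partial sums crossing both of them with small increments
gain more than the lower level in between, see `lt_pMoment_sum_Ico`. -/
noncomputable def crossingConst (p : ℝ) : ℝ≥0 := 2 ^ (p - 1) * (1 + 2 * 2 ^ (p - 1))

theorem coe_crossingConst {p : ℝ} (hp : 1 ≤ p) :
    (crossingConst p : ℝ≥0∞) = 2 ^ (p - 1) * (1 + 2 * 2 ^ (p - 1)) := by
  have coe_pow : (((2 : ℝ≥0) ^ (p - 1) : ℝ≥0) : ℝ≥0∞) = 2 ^ (p - 1) := by
    rw [ENNReal.coe_rpow_of_nonneg _ (by linarith), ENNReal.coe_ofNat]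
  simp only [crossingConst, ENNReal.coe_mul, ENNReal.coe_add, ENNReal.coe_one, ENNReal.coe_ofNat,
    coe_pow]

theorem one_le_crossingConst {p : ℝ} (hp : 1 ≤ p) : 1 ≤ crossingConst p :=
  one_le_mul (NNReal.one_le_rpow one_le_two (by linarith)) (le_add_of_nonneg_right zero_le)

variable {B : Type*} [NormedAddCommGroup B] [MeasurableSpace B] [BorelSpace B]
  [SecondCountableTopology B] {Y : Type*} [MeasurableSpace Y] {ν : Measure Y} {p : ℝ}

theorem lt_pMoment_sum_Ico (hp : 1 ≤ p) {d : ℕ → Y → B} (hd : ∀ k, Measurable (d k)) {τ σ : ℕ}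
    (hτσ : τ < σ) {l : ℝ≥0∞} (hτ : pMoment p ν (fun y => ∑ k ∈ range τ, d k y) ≤ l)
    (hdτ : pMoment p ν (d τ) ≤ l)
    (hσ : crossingConst p * l < pMoment p ν fun y => ∑ k ∈ range σ, d k y) :
    l < pMoment p ν fun y => ∑ k ∈ Ico (τ + 1) σ, d k y := by
  contrapose! hσ
  calc pMoment p ν (fun y => ∑ k ∈ range σ, d k y)
      = pMoment p ν fun y =>
          (∑ k ∈ range τ, d k y + d τ y) + ∑ k ∈ Ico (τ + 1) σ, d k y := by
        simp only [← sum_range_succ, sum_range_add_sum_Ico _ (Nat.succ_le_of_lt hτσ)]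
    _ ≤ 2 ^ (p - 1) * (pMoment p ν (fun y => ∑ k ∈ range τ, d k y + d τ y) +
          pMoment p ν fun y => ∑ k ∈ Ico (τ + 1) σ, d k y) := pMoment_add_le hp (by fun_prop)
    _ ≤ 2 ^ (p - 1) * (2 ^ (p - 1) * (l + l) + l) := by
        gcongr
        exact (pMoment_add_le hp (by fun_prop)).trans (by gcongr)
    _ = crossingConst p * l := by
        rw [coe_crossingConst hp]
        ring

end Crossing

section MaxMoment

variable {B : Type*} [NormedAddCommGroup B] {S : Type*} [MeasurableSpace S] {Y : Type*}
  [MeasurableSpace Y] {ν : Measure Y} {p : ℝ} {d : ℕ → (ℕ → S) × Y → B}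

/-- The largest of the `p`-th absolute moments, over the parameter `y`, of the partial sums
`∑_{k < n} d k (x, y)` with `n ≤ N`. -/
noncomputable def maxMoment {X : Type*} (p : ℝ) (ν : Measure Y) (d : ℕ → X × Y → B) (N : ℕ)
    (x : X) : ℝ≥0∞ :=
  (range (N + 1)).sup fun n => pMoment p ν fun y => ∑ k ∈ range n, d k (x, y)

/-- The predictable variation of the increment `d k`: its `p`-th absolute moment over the
parameter and the `k`-th coordinate of the i.i.d. sequence. -/
noncomputable def predMoment (μ : Measure S) (p : ℝ) (ν : Measure Y) (d : ℕ → (ℕ → S) × Y → B)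
    (k : ℕ) (x : ℕ → S) : ℝ≥0∞ :=
  ∫⁻ s, pMoment p ν (fun y => d k (update x k s, y)) ∂μ

theorem monotone_maxMoment {X : Type*} {d : ℕ → X × Y → B} (x : X) :
    Monotone fun N => maxMoment p ν d N x := fun _ _ h =>
  sup_mono (range_mono (Nat.succ_le_succ h))

theorem dependsOn_maxMoment {S : Type*} {d : ℕ → (ℕ → S) × Y → B}
    (hd : ∀ k y, DependsOn (fun x => d k (x, y)) (Set.Iic k)) (N : ℕ) :
    DependsOn (maxMoment p ν d N) (Set.Iio N) := fun x x' h => by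
  refine sup_congr rfl fun n hn => congrArg (pMoment p ν) (funext fun y => ?_)
  refine sum_congr rfl fun k hk => hd k y fun i hi => h i ?_
  rw [mem_range] at hn hk
  exact Set.mem_Iio.2 (by grind)

theorem dependsOn_predMoment {μ : Measure S}
    (hd : ∀ k y, DependsOn (fun x => d k (x, y)) (Set.Iic k)) (k : ℕ) :
    DependsOn (predMoment μ p ν d k) (Set.Iio k) := fun x x' h => by
  refine lintegral_congr fun s => congrArg (pMoment p ν) (funext fun y => hd k y fun i hi => ?_)
  rcases (Set.mem_Iic.1 hi).eq_or_lt with rfl | hik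
  · rw [update_self, update_self]
  · rw [update_of_ne hik.ne, update_of_ne hik.ne, h i hik]

/-- The event, known before time `k`, on which the maximum has crossed the level `a` but not yet
the level `c`, and the predictable variation up to and including time `k` is at most `v`. -/
def crossingSet (μ : Measure S) (p : ℝ) (ν : Measure Y) (d : ℕ → (ℕ → S) × Y → B)
    (a c v : ℝ≥0∞) (k : ℕ) : Set (ℕ → S) :=
  {x | (a < maxMoment p ν d k x ∧ maxMoment p ν d k x ≤ c) ∧
    ∑ j ∈ range (k + 1), predMoment μ p ν d j x ≤ v}

theorem dependsOn_mem_crossingSet {μ : Measure S} {a c v : ℝ≥0∞}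
    (hd : ∀ k y, DependsOn (fun x => d k (x, y)) (Set.Iic k)) (k : ℕ) :
    DependsOn (fun x => x ∈ crossingSet μ p ν d a c v k) (Set.Iio k) := fun x x' h => by
  have sum_eq : ∑ j ∈ range (k + 1), predMoment μ p ν d j x =
      ∑ j ∈ range (k + 1), predMoment μ p ν d j x' :=
    sum_congr rfl fun j hj => dependsOn_predMoment hd j fun i hi =>
      h i ((Set.mem_Iio.1 hi).trans_le (mem_range_succ_iff.1 hj))
  simp only [crossingSet, Set.mem_ofPred_eq, dependsOn_maxMoment hd k h, sum_eq]

theorem sum_indicator_predMoment_le {μ : Measure S} {a c v : ℝ≥0∞} (N : ℕ) (x : ℕ → S) :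
    ∑ k ∈ range N, (crossingSet μ p ν d a c v k).indicator (predMoment μ p ν d k) x ≤
      {x | a < maxMoment p ν d N x}.indicator (fun _ => v) x := by
  classical
  simp only [Set.indicator_apply, ← sum_filter]
  rcases ((range N).filter fun k => x ∈ crossingSet μ p ν d a c v k).eq_empty_or_nonempty
    with hs | hs
  · rw [hs, sum_empty]
    exact zero_le
  obtain ⟨k, hk, le_k⟩ := exists_max_image _ id hs
  obtain ⟨hkN, ⟨hak, -⟩, hsum⟩ := mem_filter.1 hk
  have hx : x ∈ {x | a < maxMoment p ν d N x} :=
    hak.trans_le (monotone_maxMoment x (mem_range.1 hkN).le)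
  rw [if_pos hx]
  exact (sum_le_sum_of_subset fun j hj => mem_range_succ_iff.2 (le_k j hj)).trans hsum

variable [MeasurableSpace B] [BorelSpace B]

theorem lt_pMoment_crossing_sum [SecondCountableTopology B] {μ : Measure S}
    (hp : 1 ≤ p) (hd : ∀ k, Measurable (d k)) {N : ℕ}
    {l v : ℝ≥0∞} {x : ℕ → S} (hmax : crossingConst p * l < maxMoment p ν d N x)
    (hsmall : ∀ k < N, pMoment p ν (fun y => d k (x, y)) ≤ l)
    (hpred : ∑ k ∈ range N, predMoment μ p ν d k x ≤ v) :
    l < pMoment p ν fun y => ∑ k ∈ range N,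
      (Prod.fst ⁻¹' crossingSet μ p ν d l (crossingConst p * l) v k).indicator (d k) (x, y) := by
  have le_level : l ≤ crossingConst p * l :=
    le_mul_of_one_le_left zero_le (by exact_mod_cast one_le_crossingConst hp)
  obtain ⟨τ, σ, hτσ, hσN, hτ, hσ, mem_iff⟩ := exists_crossing_interval
    (by simp [pMoment_zero (zero_lt_one.trans_le hp)]) le_level hmax
  have mem_crossingSet_iff : ∀ k ∈ range N,
      x ∈ crossingSet μ p ν d l (crossingConst p * l) v k ↔ k ∈ Ico (τ + 1) σ := by
    intro k hk
    have hk_pred : ∑ j ∈ range (k + 1), predMoment μ p ν d j x ≤ v :=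
      (sum_le_sum_of_subset (range_mono (mem_range.1 hk))).trans hpred
    exact (and_iff_left hk_pred).trans (mem_iff k)
  have sum_eq : ∀ y, ∑ k ∈ range N,
      (Prod.fst ⁻¹' crossingSet μ p ν d l (crossingConst p * l) v k).indicator (d k) (x, y) =
        ∑ k ∈ Ico (τ + 1) σ, d k (x, y) := by
    classical
    intro y
    simp only [Set.indicator_apply, Set.mem_preimage]
    rw [← sum_filter, filter_congr mem_crossingSet_iff, filter_mem_eq_inter, inter_eq_right.2]
    exact fun k hk => mem_range.2 ((mem_Ico.1 hk).2.trans_le hσN)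
  simp only [sum_eq]
  exact lt_pMoment_sum_Ico hp (fun k => by fun_prop) hτσ hτ (hsmall τ (hτσ.trans_le hσN)) hσ

variable [SFinite ν]

theorem measurable_predMoment {μ : Measure S} [SFinite μ] (hd : ∀ k, Measurable (d k)) (k : ℕ) :
    Measurable (predMoment μ p ν d k) :=
  Measurable.lintegral_prod_right'
    (f := fun w : (ℕ → S) × S => pMoment p ν fun y => d k (update w.1 k w.2, y))
    (measurable_pMoment (by fun_prop))

theorem pMoment_indicator_eq_lintegral_predMoment {μ : Measure S} [IsProbabilityMeasure μ]
    (hp : 0 < p) {k : ℕ} (hd : Measurable (d k)) {V : Set (ℕ → S)} (hV : MeasurableSet V)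
    (hVdep : DependsOn (fun x => x ∈ V) (Set.Iio k)) :
    pMoment p ((iidLaw ℕ μ).prod ν) ((Prod.fst ⁻¹' V).indicator (d k)) =
      ∫⁻ x, V.indicator (predMoment μ p ν d k) x ∂iidLaw ℕ μ := by
  have hm : Measurable ((Prod.fst ⁻¹' V).indicator (d k)) := hd.indicator (measurable_fst hV)
  have mem_eq : ∀ x s, update x k s ∈ V ↔ x ∈ V := fun x s =>
    iff_of_eq (hVdep fun i hi => update_of_ne (Set.mem_Iio.1 hi).ne _ _)
  rw [← lintegral_pMoment hm, ← (measurePreserving_update μ k).lintegral_comp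
    (measurable_pMoment (by fun_prop)), lintegral_prod _ (by
      refine (measurable_pMoment ?_).aemeasurable
      fun_prop)]
  classical
  refine lintegral_congr fun x => ?_
  simp only [Set.indicator_apply, Set.mem_preimage, mem_eq]
  split_ifs
  · rfl
  · simp only [pMoment_zero hp, lintegral_zero]

variable [SecondCountableTopology B]

theorem measurable_maxMoment {X : Type*} [MeasurableSpace X] {d : ℕ → X × Y → B}
    (hd : ∀ k, Measurable (d k)) (N : ℕ) : Measurable (maxMoment p ν d N) := by
  have eq_iSup : maxMoment p ν d N = fun x => ⨆ n ∈ range (N + 1),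
      pMoment p ν fun y => ∑ k ∈ range n, d k (x, y) := funext fun x => Finset.sup_eq_iSup _ _
  rw [eq_iSup]
  exact .iSup fun n => .iSup fun _ => measurable_pMoment (by fun_prop)

theorem measurableSet_crossingSet {μ : Measure S} [SFinite μ] (hd : ∀ k, Measurable (d k))
    {a c v : ℝ≥0∞} (k : ℕ) : MeasurableSet (crossingSet μ p ν d a c v k) :=
  have hmax := measurable_maxMoment (p := p) (ν := ν) hd k
  have hpred := measurable_predMoment (μ := μ) (p := p) (ν := ν) hd
  ((measurableSet_lt measurable_const hmax).inter (measurableSet_le hmax measurable_const)).inter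
    (measurableSet_le (measurable_sum _ fun j _ => hpred j) measurable_const)

end MaxMoment

section GoodLambda

variable {B : Type*} [NormedAddCommGroup B] [NormedSpace ℝ B] [MeasurableSpace B] {S : Type*}
  [MeasurableSpace S] {μ : Measure S} [IsProbabilityMeasure μ] {Y : Type*} [MeasurableSpace Y]
  {ν : Measure Y} {p : ℝ} {d : ℕ → (ℕ → S) × Y → B}

theorem IsMartingaleDiff.indicator (hd : IsMartingaleDiff p μ ν d) (hp : 0 ≤ p)
    {V : ℕ → Set (ℕ → S)} (hV : ∀ k, MeasurableSet (V k))
    (hVdep : ∀ k, DependsOn (fun x => x ∈ V k) (Set.Iio k)) :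
    IsMartingaleDiff p μ ν fun k => (Prod.fst ⁻¹' V k).indicator (d k) where
  measurable k := (hd.measurable k).indicator (measurable_fst (hV k))
  dependsOn k y x x' h := by
    have mem_eq := hVdep k fun i hi => h i (Set.mem_Iio.1 hi).le
    classical
    simp only [Set.indicator_apply, Set.mem_preimage, mem_eq, hd.dependsOn k y h]
  integral_update k := by
    filter_upwards [hd.integral_update k] with z hz
    have mem_eq : ∀ s, update z.1 k s ∈ V k ↔ z.1 ∈ V k := fun s =>
      iff_of_eq (hVdep k fun i hi => update_of_ne (Set.mem_Iio.1 hi).ne _ _)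
    classical
    simp only [Set.indicator_apply, Set.mem_preimage, mem_eq]
    split_ifs
    · exact hz
    · exact integral_zero _ _
  pMoment_ne_top k := by
    refine ne_top_of_le_ne_top (hd.pMoment_ne_top k) (lintegral_mono fun z => ?_)
    gcongr
    exact enorm_indicator_le_enorm_self _ _

variable [BorelSpace B] [SecondCountableTopology B] [SFinite ν] [CompleteSpace B]
  {ψ : Seminorm ℝ B} {C : ℝ≥0}

theorem IsMartingaleDiff.measure_lt_pMoment_crossing_sum_le (hd : IsMartingaleDiff p μ ν d)
    (hψ : IsTwoPointNorm p ψ C) (hp : 1 ≤ p) {N : ℕ} {c δ l : ℝ≥0∞} (hl0 : l ≠ 0) (hl : l ≠ ∞) :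
    iidLaw ℕ μ {x | l < pMoment p ν fun y => ∑ k ∈ range N,
        (Prod.fst ⁻¹' crossingSet μ p ν d l c (δ * l) k).indicator (d k) (x, y)} ≤
      momentConst p C * δ * iidLaw ℕ μ {x | l < maxMoment p ν d N x} := by
  have hp0 : 0 < p := by linarith
  have hVm := measurableSet_crossingSet (p := p) (ν := ν) (μ := μ) (a := l) (c := c) (v := δ * l)
    hd.measurable
  have hVdep := dependsOn_mem_crossingSet (p := p) (ν := ν) (μ := μ) (a := l) (c := c) (v := δ * l)
    hd.dependsOn
  have hd' := hd.indicator hp0.le hVm hVdep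
  have hm := hd'.measurable
  have hTm : Measurable fun z => ∑ k ∈ range N,
    (Prod.fst ⁻¹' crossingSet μ p ν d l c (δ * l) k).indicator (d k) z := by fun_prop
  rw [← ENNReal.mul_le_mul_iff_right hl0 hl]
  calc _ ≤ ∫⁻ x, pMoment p ν (fun y => ∑ k ∈ range N,
          (Prod.fst ⁻¹' crossingSet μ p ν d l c (δ * l) k).indicator (d k) (x, y)) ∂iidLaw ℕ μ := by
        refine le_trans ?_ (mul_meas_ge_le_lintegral (measurable_pMoment hTm) l)
        gcongr with x
        exact le_of_lt
    _ ≤ momentConst p C * ∑ k ∈ range N, pMoment p ((iidLaw ℕ μ).prod ν)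
          ((Prod.fst ⁻¹' crossingSet μ p ν d l c (δ * l) k).indicator (d k)) := by
        rw [lintegral_pMoment hTm]
        exact hd'.pMoment_sum_le hψ hp N
    _ = momentConst p C * ∫⁻ x, ∑ k ∈ range N,
          (crossingSet μ p ν d l c (δ * l) k).indicator (predMoment μ p ν d k) x ∂iidLaw ℕ μ := by
        rw [lintegral_finsetSum _ fun k _ =>
          (measurable_predMoment hd.measurable k).indicator (hVm k)]
        simp only [pMoment_indicator_eq_lintegral_predMoment hp0 (hd.measurable _) (hVm _)
          (hVdep _)]
    _ ≤ momentConst p C * (δ * l * iidLaw ℕ μ {x | l < maxMoment p ν d N x}) := by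
        gcongr
        rw [← lintegral_indicator_const
          (measurableSet_lt measurable_const (measurable_maxMoment hd.measurable N))]
        exact lintegral_mono (sum_indicator_predMoment_le N)
    _ = _ := by ring

theorem IsMartingaleDiff.measure_lt_maxMoment_le (hd : IsMartingaleDiff p μ ν d)
    (hψ : IsTwoPointNorm p ψ C) (hp : 1 ≤ p) {N : ℕ} {δ l : ℝ≥0∞} (hδ : δ ≤ 1)
    (hl0 : l ≠ 0) (hl : l ≠ ∞) :
    iidLaw ℕ μ {x | crossingConst p * l < maxMoment p ν d N x} ≤
      momentConst p C * δ * iidLaw ℕ μ {x | l < maxMoment p ν d N x} +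
        (∑ k ∈ range N, iidLaw ℕ μ {x | δ * l < pMoment p ν fun y => d k (x, y)} +
          iidLaw ℕ μ {x | δ * l < ∑ k ∈ range N, predMoment μ p ν d k x}) := by
  have cover : {x | crossingConst p * l < maxMoment p ν d N x} ⊆
      {x | l < pMoment p ν fun y => ∑ k ∈ range N, (Prod.fst ⁻¹'
        crossingSet μ p ν d l (crossingConst p * l) (δ * l) k).indicator (d k) (x, y)} ∪
      ((⋃ k ∈ range N, {x | δ * l < pMoment p ν fun y => d k (x, y)}) ∪
        {x | δ * l < ∑ k ∈ range N, predMoment μ p ν d k x}) := by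
    intro x hx
    by_contra! hcon
    simp only [Set.mem_union, Set.mem_iUnion, Set.mem_ofPred_eq, not_or, not_exists, not_lt,
      mem_range] at hcon
    obtain ⟨hsum, hsmall, hpred⟩ := hcon
    exact hsum.not_gt (lt_pMoment_crossing_sum hp hd.measurable hx
      (fun k hk => (hsmall k hk).trans (mul_le_of_le_one_left zero_le hδ)) hpred)
  grw [cover, measure_union_le, measure_union_le, measure_biUnion_finset_le]
  gcongr
  exact hd.measure_lt_pMoment_crossing_sum_le hψ hp hl0 hl

end GoodLambda

/-! ### Truncated moments of the maximum of a martingale -/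

section Integrated

variable {Ω ι : Type*} [MeasurableSpace Ω] {P : Measure Ω} {κ : ℝ} {V : Ω → ℝ≥0∞}
  {W : ι → Ω → ℝ≥0∞} {s : Finset ι} {ε : ℝ≥0∞} {b δ : ℝ≥0}

theorem measurable_tailIntegral_integrand (P : Measure Ω) (q : ℝ) {t : ℝ} (ht : 0 ≤ t)
    (Y : Ω → ℝ≥0∞) : Measurable fun u : ℝ =>
      ENNReal.ofReal (u ^ (q - 1)) * P {ω | ENNReal.ofReal (t * u) < Y ω} := by
  have tail : Antitone fun u : ℝ => P {ω | ENNReal.ofReal (t * u) < Y ω} := fun u v huv =>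
    measure_mono fun ω (hω : _ < _) =>
      (ENNReal.ofReal_le_ofReal (mul_le_mul_of_nonneg_left huv ht)).trans_lt hω
  have weight : Measurable fun u : ℝ => ENNReal.ofReal (u ^ (q - 1)) := by fun_prop
  exact weight.mul tail.measurable

theorem tailIntegral_le_of_measure_lt_le
    (h : ∀ u : ℝ≥0, 0 < u →
      P {ω | b * u < V ω} ≤ ε * P {ω | u < V ω} + ∑ i ∈ s, P {ω | δ * u < W i ω}) :
    tailIntegral P κ b V ≤ ε * tailIntegral P κ 1 V + ∑ i ∈ s, tailIntegral P κ δ (W i) := by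
  simp only [tailIntegral]
  rw [← lintegral_const_mul _ (measurable_tailIntegral_integrand P κ zero_le_one V),
    ← lintegral_finsetSum _ fun i _ => measurable_tailIntegral_integrand P κ δ.coe_nonneg (W i),
    ← lintegral_add_left
      ((measurable_tailIntegral_integrand P κ zero_le_one V).const_mul _)]
  refine setLIntegral_mono' measurableSet_Ioo fun u hu => ?_
  have good := h u.toNNReal (Real.toNNReal_pos.2 hu.1)
  simp only [one_mul, ENNReal.ofReal_mul NNReal.zero_le_coe, ENNReal.ofReal_coe_nnreal]
  calc _ ≤ ENNReal.ofReal (u ^ (κ - 1)) * _ := mul_le_mul_right good _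
    _ = _ := by
        rw [mul_add, mul_sum, mul_left_comm]
        rfl

theorem lintegral_truncRpow_div_le_of_measure_lt_le (hκ : 0 < κ) (hV : AEMeasurable V P)
    (hW : ∀ i, AEMeasurable (W i) P) (hb : 0 < b) (hδ : 0 < δ)
    (h : ∀ u : ℝ≥0, 0 < u →
      P {ω | b * u < V ω} ≤ ε * P {ω | u < V ω} + ∑ i ∈ s, P {ω | δ * u < W i ω}) :
    ∫⁻ ω, truncRpow κ (V ω / b) ∂P ≤
      ε * ∫⁻ ω, truncRpow κ (V ω) ∂P + ∑ i ∈ s, ∫⁻ ω, truncRpow κ (W i ω / δ) ∂P := by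
  have layer : ∀ (t : ℝ≥0) (Y : Ω → ℝ≥0∞), 0 < t → AEMeasurable Y P →
      ∫⁻ ω, truncRpow κ (Y ω / t) ∂P = ENNReal.ofReal κ * tailIntegral P κ t Y := by
    intro t Y ht hY
    rw [← lintegral_truncRpow P hκ (NNReal.coe_pos.2 ht) hY, ENNReal.ofReal_coe_nnreal]
  have layer_one := layer 1 V one_pos hV
  simp only [ENNReal.coe_one, div_one, NNReal.coe_one] at layer_one
  simp only [layer_one, layer b V hb hV, fun i => layer δ (W i) hδ (hW i), ← mul_sum,
    mul_left_comm ε, ← mul_add]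
  gcongr
  exact tailIntegral_le_of_measure_lt_le h

theorem le_two_mul_of_le_half_add {I R : ℝ≥0∞} (hI : I ≠ ∞) (h : I ≤ 2⁻¹ * I + R) :
    I ≤ 2 * R := by
  have half_ne_top : 2⁻¹ * I ≠ ∞ := ENNReal.mul_ne_top (by simp) hI
  have half_le : 2⁻¹ * I ≤ R := by
    refine (ENNReal.add_le_add_iff_left half_ne_top).1 ?_
    rwa [← add_mul, ENNReal.inv_two_add_inv_two, one_mul]
  rwa [ENNReal.inv_mul_le_iff two_ne_zero ENNReal.ofNat_ne_top] at half_le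

theorem lintegral_truncRpow_le_of_measure_lt_le [IsFiniteMeasure P] (hκ : 0 < κ)
    (hV : Measurable V) (hW : ∀ i, Measurable (W i)) (hb : 1 ≤ b) (hδ0 : 0 < δ) (hδ : δ ≤ 1)
    (hε : (b : ℝ≥0∞) ^ κ * ε ≤ 2⁻¹)
    (h : ∀ u : ℝ≥0, 0 < u →
      P {ω | b * u < V ω} ≤ ε * P {ω | u < V ω} + ∑ i ∈ s, P {ω | δ * u < W i ω}) :
    ∫⁻ ω, truncRpow κ (V ω) ∂P ≤
      2 * (b ^ κ * (δ : ℝ≥0∞)⁻¹ ^ κ * ∑ i ∈ s, ∫⁻ ω, truncRpow κ (W i ω) ∂P) := by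
  have finite : ∫⁻ ω, truncRpow κ (V ω) ∂P ≠ ∞ := by
    refine ne_top_of_le_ne_top (measure_ne_top P Set.univ) ?_
    grw [lintegral_mono fun ω => truncRpow_le_one hκ.le (V ω), lintegral_one]
  have scale : ∀ {c : ℝ≥0∞} {F : Ω → ℝ≥0∞}, 1 ≤ c → Measurable F →
      ∫⁻ ω, truncRpow κ (c * F ω) ∂P ≤ c ^ κ * ∫⁻ ω, truncRpow κ (F ω) ∂P := by
    intro c F hc hF
    rw [← lintegral_const_mul _ (by fun_prop)]
    exact lintegral_mono fun ω => truncRpow_mul_le hκ.le hc _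
  have hb0 : (b : ℝ≥0∞) ≠ 0 := ENNReal.coe_ne_zero.2 (one_pos.trans_le hb).ne'
  refine le_two_mul_of_le_half_add finite ?_
  calc ∫⁻ ω, truncRpow κ (V ω) ∂P = ∫⁻ ω, truncRpow κ (b * (V ω / b)) ∂P := by
        simp only [ENNReal.mul_div_cancel hb0 ENNReal.coe_ne_top]
    _ ≤ b ^ κ * ∫⁻ ω, truncRpow κ (V ω / b) ∂P :=
        scale (by exact_mod_cast hb) (hV.div_const _)
    _ ≤ b ^ κ * (ε * ∫⁻ ω, truncRpow κ (V ω) ∂P +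
          ∑ i ∈ s, (δ : ℝ≥0∞)⁻¹ ^ κ * ∫⁻ ω, truncRpow κ (W i ω) ∂P) := by
        grw [lintegral_truncRpow_div_le_of_measure_lt_le hκ hV.aemeasurable
          (fun i => (hW i).aemeasurable) (one_pos.trans_le hb) hδ0 h]
        simp only [div_eq_mul_inv, mul_comm _ (δ : ℝ≥0∞)⁻¹]
        gcongr with i
        exact scale (ENNReal.one_le_inv.2 (by exact_mod_cast hδ)) (hW i)
    _ = b ^ κ * ε * ∫⁻ ω, truncRpow κ (V ω) ∂P +
          b ^ κ * (δ : ℝ≥0∞)⁻¹ ^ κ * ∑ i ∈ s, ∫⁻ ω, truncRpow κ (W i ω) ∂P := by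
        rw [← mul_sum]
        ring
    _ ≤ _ := by gcongr

end Integrated

section MaximalInequality

/-- The inverse of the factor by which the levels for the increments and for the predictable
variation are lowered in the good-λ inequality, chosen so that the recurring term enters the
integrated inequality with a factor of at most one half. -/
noncomputable def levelRatio (p : ℝ) (C : ℝ≥0) (κ : ℝ) : ℝ≥0 :=
  1 + 2 * momentConst p C * crossingConst p ^ κ

/-- The constant of the maximal inequality `IsMartingaleDiff.lintegral_truncRpow_maxMoment_le`. -/
noncomputable def maximalConst (p : ℝ) (C : ℝ≥0) (κ : ℝ) : ℝ≥0 :=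
  2 * (crossingConst p ^ κ * levelRatio p C κ ^ κ)

theorem one_le_levelRatio {p : ℝ} {C : ℝ≥0} {κ : ℝ} : 1 ≤ levelRatio p C κ :=
  le_add_of_nonneg_right zero_le

theorem crossingConst_rpow_mul_le_half {p : ℝ} {C : ℝ≥0} {κ : ℝ} :
    crossingConst p ^ κ * (momentConst p C * (levelRatio p C κ)⁻¹) ≤ 2⁻¹ := by
  rw [← mul_assoc, ← div_eq_mul_inv, div_le_iff₀ (one_pos.trans_le one_le_levelRatio),
    levelRatio, mul_add, mul_one]
  refine le_add_of_nonneg_of_le zero_le (le_of_eq ?_)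
  rw [mul_assoc, inv_mul_cancel_left₀ two_ne_zero, mul_comm]

variable {B : Type*} [NormedAddCommGroup B] [NormedSpace ℝ B] [CompleteSpace B]
  [MeasurableSpace B] [BorelSpace B] [SecondCountableTopology B] {S : Type*} [MeasurableSpace S]
  {μ : Measure S} [IsProbabilityMeasure μ] {Y : Type*} [MeasurableSpace Y] {ν : Measure Y}
  [SFinite ν] {p : ℝ} {d : ℕ → (ℕ → S) × Y → B} {ψ : Seminorm ℝ B} {C : ℝ≥0}

theorem IsMartingaleDiff.lintegral_truncRpow_maxMoment_le (hd : IsMartingaleDiff p μ ν d)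
    (hψ : IsTwoPointNorm p ψ C) (hp : 1 ≤ p) {κ : ℝ} (hκ : 0 < κ) (N : ℕ) :
    ∫⁻ x, truncRpow κ (maxMoment p ν d N x) ∂iidLaw ℕ μ ≤
      maximalConst p C κ *
        (∑ k ∈ range N, ∫⁻ x, truncRpow κ (pMoment p ν fun y => d k (x, y)) ∂iidLaw ℕ μ +
          ∫⁻ x, truncRpow κ (∑ k ∈ range N, predMoment μ p ν d k x) ∂iidLaw ℕ μ) := by
  have hdm := hd.measurable
  set δ : ℝ≥0 := (levelRatio p C κ)⁻¹ with hδ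
  have hδ0 : 0 < δ := inv_pos.2 (one_pos.trans_le one_le_levelRatio)
  have hδ1 : δ ≤ 1 := inv_le_one_of_one_le₀ one_le_levelRatio
  have hε : (crossingConst p : ℝ≥0∞) ^ κ * (momentConst p C * δ) ≤ 2⁻¹ := by
    rw [← ENNReal.coe_rpow_of_nonneg _ hκ.le, ← ENNReal.coe_ofNat, ← ENNReal.coe_inv two_ne_zero]
    exact_mod_cast crossingConst_rpow_mul_le_half
  let W : Option ℕ → (ℕ → S) → ℝ≥0∞ := fun o x =>
    o.elim (∑ k ∈ range N, predMoment μ p ν d k x) fun k => pMoment p ν fun y => d k (x, y)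
  have hW : ∀ o, Measurable (W o) := by
    rintro (_ | k)
    · exact measurable_sum _ fun j _ => measurable_predMoment hdm j
    · exact measurable_pMoment (hdm k)
  have good_lambda : ∀ u : ℝ≥0, 0 < u →
      iidLaw ℕ μ {x | crossingConst p * u < maxMoment p ν d N x} ≤
        momentConst p C * δ * iidLaw ℕ μ {x | u < maxMoment p ν d N x} +
          ∑ o ∈ insertNone (range N), iidLaw ℕ μ {x | δ * u < W o x} := by
    intro u hu
    rw [sum_insertNone, add_comm (iidLaw ℕ μ _)]
    exact hd.measure_lt_maxMoment_le hψ hp (by exact_mod_cast hδ1) (by exact_mod_cast hu.ne')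
      ENNReal.coe_ne_top
  have integrated := lintegral_truncRpow_le_of_measure_lt_le hκ (measurable_maxMoment hdm N) hW
    (one_le_crossingConst hp) hδ0 hδ1 hε good_lambda
  rw [sum_insertNone, add_comm, ← ENNReal.coe_inv hδ0.ne', hδ, inv_inv,
    ← ENNReal.coe_rpow_of_nonneg _ hκ.le, ← ENNReal.coe_rpow_of_nonneg _ hκ.le] at integrated
  rw [maximalConst, ENNReal.coe_mul, ENNReal.coe_mul, ENNReal.coe_ofNat, mul_assoc]
  exact integrated

end MaximalInequality

/-! ### Degenerate families -/

section Powersets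

theorem sum_powersetCard_succ_range {M : Type*} [AddCommMonoid M] (F : Finset ℕ → M) (m N : ℕ) :
    ∑ I ∈ (range N).powersetCard (m + 1), F I =
      ∑ n ∈ range N, ∑ I ∈ (range n).powersetCard m, F (insert n I) := by
  induction N with
  | zero => rw [range_zero, powersetCard_eq_empty.2 (by simp), sum_empty, sum_empty]
  | succ N ih =>
    have notMem : ∀ I ∈ (range N).powersetCard m, N ∉ I := fun I hI h =>
      notMem_range_self ((mem_powersetCard.1 hI).1 h)
    rw [sum_range_succ, ← ih, range_add_one, powersetCard_succ_insert notMem_range_self,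
      sum_union, sum_image]
    · intro I hI J hJ h
      rw [← erase_insert (notMem I hI), ← erase_insert (notMem J hJ), h]
    · rw [disjoint_left]
      intro I hI hI'
      obtain ⟨J, -, rfl⟩ := mem_image.1 hI'
      exact notMem_range_self ((mem_powersetCard.1 hI).1 (mem_insert_self N J))

theorem sum_powerset_range {M : Type*} [AddCommMonoid M] (F : Finset ℕ → M) (N : ℕ) :
    ∑ A ∈ (range N).powerset, F A =
      F ∅ + ∑ n ∈ range N, ∑ A ∈ (range n).powerset, F (insert n A) := by
  induction N with
  | zero => simp
  | succ N ih =>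
    rw [sum_range_succ, ← add_assoc, ← ih, range_add_one, sum_powerset_insert notMem_range_self]

theorem filter_powersetCard_range {m n N : ℕ} (hn : n ≤ N) :
    ((range N).powersetCard m).filter (· ⊆ range n) = (range n).powersetCard m := by
  ext I
  simp only [mem_filter, mem_powersetCard]
  exact ⟨fun h => ⟨h.2, h.1.2⟩, fun h => ⟨⟨h.1.trans (range_mono hn), h.2⟩, h.1⟩⟩

end Powersets

section DegenerateFamily

variable {B : Type*} [NormedAddCommGroup B] {S : Type*} {Y : Type*} {p : ℝ}
  {f : Finset ℕ → (ℕ → S) × Y → B} {m N : ℕ}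

/-- The increments of the partial sums `∑ I ∈ (range n).powersetCard (m + 1), f I`: the terms
with largest index `k`. -/
def increment (f : Finset ℕ → (ℕ → S) × Y → B) (m k : ℕ) (z : (ℕ → S) × Y) : B :=
  ∑ I ∈ (range k).powersetCard m, f (insert k I) z

section MaxStat

variable [MeasurableSpace Y] {ν : Measure Y}

/-- The maximum over `n ≤ N` of the `p`-th moments, over the parameter, of the sums of the `f I`
over the `m`-element sets `I ⊆ {0, …, n - 1}`. -/
noncomputable def maxStat (p : ℝ) (ν : Measure Y) (f : Finset ℕ → (ℕ → S) × Y → B) (m N : ℕ)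
    (x : ℕ → S) : ℝ≥0∞ :=
  (range (N + 1)).sup fun n => pMoment p ν fun y => ∑ I ∈ (range n).powersetCard m, f I (x, y)

theorem pMoment_le_maxStat {n : ℕ} (hn : n ≤ N) (x : ℕ → S) :
    (pMoment p ν fun y => ∑ I ∈ (range n).powersetCard m, f I (x, y)) ≤ maxStat p ν f m N x :=
  le_sup (f := fun n => pMoment p ν fun y => ∑ I ∈ (range n).powersetCard m, f I (x, y))
    (mem_range_succ_iff.2 hn)

theorem measurable_maxStat [MeasurableSpace S] [MeasurableSpace B] [BorelSpace B]
    [SecondCountableTopology B] [SFinite ν] (hf : ∀ I, Measurable (f I)) :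
    Measurable (maxStat p ν f m N) := by
  have eq_iSup : maxStat p ν f m N = fun x => ⨆ n ∈ range (N + 1),
      pMoment p ν fun y => ∑ I ∈ (range n).powersetCard m, f I (x, y) :=
    funext fun x => Finset.sup_eq_iSup _ _
  rw [eq_iSup]
  exact .iSup fun n => .iSup fun _ => measurable_pMoment (by fun_prop)

theorem maxMoment_increment (x : ℕ → S) :
    maxMoment p ν (increment f m) N x = maxStat p ν f (m + 1) N x := by
  simp only [maxMoment, maxStat, increment, sum_powersetCard_succ_range]

end MaxStat

variable [MeasurableSpace S] [MeasurableSpace Y] {μ : Measure S} {ν : Measure Y}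

/-- The conditional `p`-th moment of `F` given the coordinates in `A`, integrated over the
parameter. -/
noncomputable def condMoment (μ : Measure S) (p : ℝ) (ν : Measure Y) (A : Finset ℕ)
    (F : (ℕ → S) × Y → B) (x : ℕ → S) : ℝ≥0∞ :=
  ∫⁻ w, pMoment p ν (fun y => F (A.piecewise x w, y)) ∂iidLaw ℕ μ

/-- The sum of the conditional `p`-th moments, given the coordinates in `A`, of those `f I` that
involve all of these coordinates. -/
noncomputable def condMomentSum (μ : Measure S) (p : ℝ) (ν : Measure Y)
    (f : Finset ℕ → (ℕ → S) × Y → B) (m N : ℕ) (A : Finset ℕ) (x : ℕ → S) : ℝ≥0∞ :=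
  ∑ I ∈ (range N).powersetCard m with A ⊆ I, condMoment μ p ν A (f I) x

/-- A family of functions indexed by the finite sets of indices, such that `f I (x, y)` depends
only on the parameter `y` and the coordinates of `x` in `I`, is centred in each of these
coordinates, and has a finite `p`-th moment. -/
structure IsDegenerateFamily [NormedSpace ℝ B] [MeasurableSpace B] (p : ℝ) (μ : Measure S)
    [IsProbabilityMeasure μ] (ν : Measure Y) (f : Finset ℕ → (ℕ → S) × Y → B) : Prop where
  measurable : ∀ I, Measurable (f I)
  dependsOn : ∀ I y, DependsOn (fun x => f I (x, y)) I
  integral_update : ∀ I, ∀ k ∈ I,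
    ∀ᵐ z ∂(iidLaw ℕ μ).prod ν, ∫ s, f I (update z.1 k s, z.2) ∂μ = 0
  pMoment_ne_top : ∀ I, pMoment p ((iidLaw ℕ μ).prod ν) (f I) ≠ ∞

variable [SFinite ν] [MeasurableSpace B] [BorelSpace B]

variable [IsProbabilityMeasure μ]

theorem measurable_condMoment {A : Finset ℕ} {F : (ℕ → S) × Y → B} (hF : Measurable F) :
    Measurable (condMoment μ p ν A F) :=
  Measurable.lintegral_prod_right'
    (f := fun z : (ℕ → S) × (ℕ → S) => pMoment p ν fun y => F (A.piecewise z.1 z.2, y))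
    (measurable_pMoment (by fun_prop))

theorem measurable_condMomentSum (hf : ∀ I, Measurable (f I)) (A : Finset ℕ) :
    Measurable (condMomentSum μ p ν f m N A) :=
  measurable_sum _ fun I _ => measurable_condMoment (hf I)

theorem lintegral_condMoment_update {A : Finset ℕ} {n : ℕ} (hn : n ∉ A) {F : (ℕ → S) × Y → B}
    (hF : Measurable F) (x : ℕ → S) :
    ∫⁻ s, condMoment μ p ν A (fun z => F (update z.1 n s, z.2)) x ∂μ = condMoment μ p ν A F x := by
  have hm : Measurable fun w : ℕ → S => pMoment p ν fun y => F (A.piecewise x w, y) :=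
    measurable_pMoment (by fun_prop)
  simp only [condMoment, update_piecewise_of_notMem _ _ _ hn]
  rw [← (measurePreserving_update μ n).lintegral_comp hm]
  exact (lintegral_prod_symm _
    (hm.comp (measurePreserving_update μ n).measurable).aemeasurable).symm

theorem IsDegenerateFamily.isMartingaleDiff_increment [NormedSpace ℝ B]
    [SecondCountableTopology B] (hf : IsDegenerateFamily p μ ν f) (hp : 1 ≤ p) (m : ℕ) :
    IsMartingaleDiff p μ ν (increment f m) where
  measurable k := by
    have hfm := hf.measurable
    unfold increment
    fun_prop
  dependsOn k y x x' h := sum_congr rfl fun I hI =>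
    hf.dependsOn (insert k I) y fun i hi => h i <| by
      rcases mem_insert.1 hi with rfl | hi
      · exact Set.mem_Iic.2 le_rfl
      · exact (mem_range.1 ((mem_powersetCard.1 hI).1 hi)).le
  integral_update k := by
    have terms : ∀ᵐ z ∂(iidLaw ℕ μ).prod ν, ∀ I,
        ∫ s, f (insert k I) (update z.1 k s, z.2) ∂μ = 0 ∧
          Integrable (fun s => f (insert k I) (update z.1 k s, z.2)) μ :=
      ae_all_iff.2 fun I => (hf.integral_update _ k (mem_insert_self k I)).and
        (ae_integrable_of_pMoment_ne_top hp (measurePreserving_update_prod μ ν k)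
          (hf.measurable _) (hf.pMoment_ne_top _))
    filter_upwards [terms] with z hz
    simp only [increment]
    rw [integral_finsetSum _ fun I _ => (hz I).2]
    exact sum_eq_zero fun I _ => (hz I).1
  pMoment_ne_top k := pMoment_sum_ne_top (by linarith) (fun _ => hf.measurable _)
    fun _ => hf.pMoment_ne_top _

end DegenerateFamily

/-! ### Reduction of the order of a degenerate family -/

section Freeze

variable {B : Type*} [NormedAddCommGroup B] {S : Type*} {Y : Type*} {p : ℝ}
  {f : Finset ℕ → (ℕ → S) × Y → B} {m n N : ℕ} {I A : Finset ℕ}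

/-- The family of lower order consisting of the terms of `f` with largest index `n`, in which the
coordinate `n` is fixed to be `s`. -/
def freeze (f : Finset ℕ → (ℕ → S) × Y → B) (n : ℕ) (s : S) (I : Finset ℕ) (z : (ℕ → S) × Y) : B :=
  if I ⊆ range n then f (insert n I) (update z.1 n s, z.2) else 0

theorem sum_freeze (hn : n ≤ N) (s : S) (z : (ℕ → S) × Y) :
    ∑ I ∈ (range N).powersetCard m, freeze f n s I z = increment f m n (update z.1 n s, z.2) := by
  simp only [freeze, increment, ← sum_filter, filter_powersetCard_range hn]

theorem dependsOn_freeze (hf : ∀ I y, DependsOn (fun x => f I (x, y)) I) (s : S) (y : Y) :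
    DependsOn (fun x => freeze f n s I (x, y)) I := by
  intro x x' h
  simp only [freeze]
  refine if_congr Iff.rfl (hf (insert n I) y fun i hi => ?_) rfl
  rcases eq_or_ne i n with rfl | hin
  · simp only [update_self]
  · simp only [update_of_ne hin]
    exact h i ((mem_insert.1 hi).resolve_left hin)

variable [MeasurableSpace S] [MeasurableSpace Y] {μ : Measure S} {ν : Measure Y}

theorem condMomentSum_freeze_le (hn : n < N) (s : S) (x : ℕ → S) :
    condMomentSum μ p ν (freeze f n s) m n A x ≤
      condMomentSum μ p ν f (m + 1) N (insert n A) (update x n s) := by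
  have term_eq : ∀ I ∈ (range n).powersetCard m, condMoment μ p ν A (freeze f n s I) x =
      condMoment μ p ν (insert n A) (f (insert n I)) (update x n s) := by
    intro I hI
    simp only [condMoment, freeze, if_pos (mem_powersetCard.1 hI).1, piecewise_insert,
      update_self, update_piecewise, update_idem]
  simp only [condMomentSum, sum_filter, sum_powersetCard_succ_range]
  refine le_trans (sum_le_sum fun I hI => ?_) (single_le_sum (f := fun k =>
    ∑ I ∈ (range k).powersetCard m, if insert n A ⊆ insert k I then
      condMoment μ p ν (insert n A) (f (insert k I)) (update x n s) else 0)
    (fun _ _ => zero_le) (mem_range.2 hn))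
  by_cases hAI : A ⊆ I
  · rw [if_pos hAI, if_pos (insert_subset_insert n hAI), term_eq I hI]
  · rw [if_neg hAI]
    exact zero_le

variable [MeasurableSpace B]

theorem measurable_freeze (hf : ∀ I, Measurable (f I)) :
    Measurable fun w : ((ℕ → S) × Y) × S => freeze f n w.2 I w.1 := by
  simp only [freeze]
  split_ifs <;> fun_prop

variable [IsProbabilityMeasure μ] [SFinite ν]

theorem pMoment_freeze_ne_top [BorelSpace B] (hp : 0 < p) (hf : Measurable (f (insert n I)))
    (hfin : pMoment p ((iidLaw ℕ μ).prod ν) (f (insert n I)) ≠ ∞) :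
    pMoment p (((iidLaw ℕ μ).prod ν).prod μ) (fun w => freeze f n w.2 I w.1) ≠ ∞ := by
  simp only [freeze]
  split_ifs
  · rwa [pMoment, ← (measurePreserving_update_prod μ ν n).lintegral_comp (by fun_prop)] at hfin
  · rw [pMoment_zero hp]
    exact ENNReal.zero_ne_top

theorem ae_integral_freeze_update [NormedSpace ℝ B] (hf : IsDegenerateFamily p μ ν f) {k : ℕ}
    (hk : k ∈ I) :
    ∀ᵐ w ∂((iidLaw ℕ μ).prod ν).prod μ, ∫ s, freeze f n w.2 I (update w.1.1 k s, w.1.2) ∂μ = 0 := by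
  by_cases hI : I ⊆ range n
  · have hkn : k ≠ n := (mem_range.1 (hI hk)).ne
    filter_upwards [(measurePreserving_update_prod μ ν n).quasiMeasurePreserving.ae
      (hf.integral_update (insert n I) k (mem_insert_of_mem hk))] with w hw
    simpa only [freeze, if_pos hI, update_comm hkn] using hw
  · simp only [freeze, if_neg hI, integral_zero, Filter.eventually_true]

theorem IsDegenerateFamily.ae_freeze [NormedSpace ℝ B] [BorelSpace B]
    (hf : IsDegenerateFamily p μ ν f) (hp : 0 < p) (n : ℕ) :
    ∀ᵐ s ∂μ, IsDegenerateFamily p μ ν (freeze f n s) := by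
  have hm : ∀ I, Measurable fun w : ((ℕ → S) × Y) × S => freeze f n w.2 I w.1 := fun I =>
    measurable_freeze hf.measurable
  have centred : ∀ᵐ s ∂μ, ∀ I k, k ∈ I → ∀ᵐ z ∂(iidLaw ℕ μ).prod ν,
      ∫ s', freeze f n s I (update z.1 k s', z.2) ∂μ = 0 := by
    simp only [ae_all_iff]
    exact fun I k hk => Measure.ae_ae_of_ae_prod <|
      Measure.measurePreserving_swap.quasiMeasurePreserving.ae (ae_integral_freeze_update hf hk)
  have finite : ∀ᵐ s ∂μ, ∀ I, pMoment p ((iidLaw ℕ μ).prod ν) (freeze f n s I) ≠ ∞ := by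
    refine ae_all_iff.2 fun I => ?_
    have hfin := pMoment_freeze_ne_top hp (hf.measurable _) (hf.pMoment_ne_top (insert n I))
    have hmI := (hm I).enorm.pow_const p
    rw [pMoment, lintegral_prod_symm _ hmI.aemeasurable] at hfin
    filter_upwards [ae_lt_top hmI.lintegral_prod_left' hfin] with s hs
    exact hs.ne
  filter_upwards [centred, finite] with s hs hfin
  exact ⟨fun I => (hm I).comp measurable_prodMk_right, fun I => dependsOn_freeze hf.dependsOn s,
    hs, hfin⟩

/- Conditionally on the coordinate `n`, the `n`-th increment is the sum of a degenerate family of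
lower order. -/
theorem IsDegenerateFamily.lintegral_truncRpow_increment_le [NormedSpace ℝ B] [BorelSpace B]
    [SecondCountableTopology B] (hf : IsDegenerateFamily p μ ν f) (hp : 0 < p) {κ : ℝ}
    (hκ : 0 ≤ κ) {K : ℝ≥0∞} (hn : n < N)
    (bound : ∀ g : Finset ℕ → (ℕ → S) × Y → B, IsDegenerateFamily p μ ν g →
      ∫⁻ x, truncRpow κ (maxStat p ν g m n x) ∂iidLaw ℕ μ ≤ K * ∑ A ∈ (range n).powerset,
        ∫⁻ x, truncRpow κ (condMomentSum μ p ν g m n A x) ∂iidLaw ℕ μ) :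
    ∫⁻ x, truncRpow κ (pMoment p ν fun y => increment f m n (x, y)) ∂iidLaw ℕ μ ≤
      K * ∑ A ∈ (range n).powerset,
        ∫⁻ x, truncRpow κ (condMomentSum μ p ν f (m + 1) N (insert n A) x) ∂iidLaw ℕ μ := by
  have hfm := hf.measurable
  have disintegrate : ∀ F : (ℕ → S) → ℝ≥0∞, Measurable F →
      ∫⁻ x, F x ∂iidLaw ℕ μ = ∫⁻ s, ∫⁻ x, F (update x n s) ∂iidLaw ℕ μ ∂μ := by
    intro F hF
    rw [← (measurePreserving_update μ n).lintegral_comp hF, lintegral_prod_symm _ (by fun_prop)]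
  have hV : ∀ A, Measurable fun x => truncRpow κ (condMomentSum μ p ν f (m + 1) N A x) := fun A =>
    measurable_truncRpow (measurable_condMomentSum hfm A)
  have hinc : Measurable (increment f m n) := by
    unfold increment
    fun_prop
  have hV' : ∀ A, Measurable fun s => ∫⁻ x,
      truncRpow κ (condMomentSum μ p ν f (m + 1) N (insert n A) (update x n s)) ∂iidLaw ℕ μ :=
    fun A => Measurable.lintegral_prod_left' (f := fun z : (ℕ → S) × S =>
      truncRpow κ (condMomentSum μ p ν f (m + 1) N (insert n A) (update z.1 n z.2)))
      ((hV (insert n A)).comp (by fun_prop))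
  rw [disintegrate _ (measurable_truncRpow (measurable_pMoment hinc)),
    sum_congr rfl fun A _ => disintegrate _ (hV (insert n A)),
    ← lintegral_finsetSum _ fun A _ => hV' A,
    ← lintegral_const_mul _ (measurable_sum _ fun A _ => hV' A)]
  refine lintegral_mono_ae ?_
  filter_upwards [hf.ae_freeze hp n] with s hs
  refine le_trans (lintegral_mono fun x => truncRpow_mono hκ ?_) ((bound _ hs).trans ?_)
  · simpa only [sum_freeze le_rfl] using
      pMoment_le_maxStat (p := p) (ν := ν) (f := freeze f n s) (m := m) (N := n) le_rfl x
  · gcongr with A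
    exact truncRpow_mono hκ (condMomentSum_freeze_le hn s _)

end Freeze

section Resample

variable {B : Type*} [NormedAddCommGroup B] {S : Type*} {Y : Type*} {p : ℝ} {N m : ℕ}
  {f : Finset ℕ → (ℕ → S) × Y → B} {I A : Finset ℕ}

/-- The family of lower order obtained from the terms of `f` with indices below `N` by resampling
the coordinate with the largest index; its index `n` and its new value become part of the
parameter. -/
def resample (f : Finset ℕ → (ℕ → S) × Y → B) (N : ℕ) (I : Finset ℕ)
    (z : (ℕ → S) × ((Y × S) × Fin N)) : B :=
  freeze f z.2.2 z.2.1.2 I (z.1, z.2.1.1)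

variable [MeasurableSpace S] [MeasurableSpace Y] {μ : Measure S} {ν : Measure Y}

/-- The measure on the parameters of a family `resample f N`. -/
noncomputable abbrev resampleParam (ν : Measure Y) (μ : Measure S) (N : ℕ) :
    Measure ((Y × S) × Fin N) :=
  (ν.prod μ).prod Measure.count

theorem measurePreserving_resampleParam [SFinite ν] [IsProbabilityMeasure μ] :
    MeasurePreserving
      (fun z : (ℕ → S) × ((Y × S) × Fin N) => (((z.1, z.2.1.1), z.2.1.2), z.2.2))
      ((iidLaw ℕ μ).prod (resampleParam ν μ N))
      ((((iidLaw ℕ μ).prod ν).prod μ).prod Measure.count) :=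
  ((measurePreserving_prodAssoc _ ν μ).symm.prod (.id _)).comp
    (measurePreserving_prodAssoc _ (ν.prod μ) _).symm

theorem ae_prod_count {X ι : Type*} [MeasurableSpace X] [Countable ι] [MeasurableSpace ι]
    {Q : Measure X} {P : X × ι → Prop} (h : ∀ i, ∀ᵐ x ∂Q, P (x, i)) :
    ∀ᵐ z ∂Q.prod Measure.count, P z := by
  have cover : {z | ¬P z} ⊆ ⋃ i, {x | ¬P (x, i)} ×ˢ {i} := fun z hz =>
    Set.mem_iUnion.2 ⟨z.2, hz, rfl⟩
  refine measure_mono_null cover (measure_iUnion_null fun i => ?_)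
  rw [Measure.prod_prod, ae_iff.1 (h i), zero_mul]

variable [MeasurableSpace B]

theorem measurable_uncurry_freeze (hf : ∀ I, Measurable (f I)) :
    Measurable fun z : (((ℕ → S) × Y) × S) × Fin N => freeze f z.2 z.1.2 I z.1.1 :=
  measurable_from_prod_countable_left fun n => measurable_freeze (n := n) (I := I) hf

theorem measurable_resample (hf : ∀ I, Measurable (f I)) : Measurable (resample f N I) :=
  (measurable_uncurry_freeze hf).comp (by fun_prop :
    Measurable fun z : (ℕ → S) × ((Y × S) × Fin N) => (((z.1, z.2.1.1), z.2.1.2), z.2.2))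

theorem pMoment_resampleParam [SFinite μ] [SFinite ν] [BorelSpace B] {g : (Y × S) × Fin N → B}
    (hg : Measurable g) :
    pMoment p (resampleParam ν μ N) g =
      ∑ n, ∫⁻ s, pMoment p ν (fun y => g ((y, s), n)) ∂μ := by
  rw [pMoment, lintegral_prod_symm _ (by fun_prop), lintegral_count, tsum_fintype]
  exact sum_congr rfl fun n _ => lintegral_prod_symm _ (by fun_prop)

variable [IsProbabilityMeasure μ] [SFinite ν] [BorelSpace B]

theorem IsDegenerateFamily.resample [NormedSpace ℝ B] (hf : IsDegenerateFamily p μ ν f)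
    (hp : 0 < p) (N : ℕ) :
    IsDegenerateFamily p μ (resampleParam ν μ N) (resample f N) where
  measurable I := measurable_resample hf.measurable
  dependsOn I y := dependsOn_freeze (n := y.2) hf.dependsOn y.1.2 y.1.1
  integral_update I k hk := by
    have centred : ∀ᵐ w ∂(((iidLaw ℕ μ).prod ν).prod μ).prod (Measure.count : Measure (Fin N)),
        ∫ s, freeze f w.2 w.1.2 I (update w.1.1.1 k s, w.1.1.2) ∂μ = 0 :=
      ae_prod_count fun n => ae_integral_freeze_update (n := n) hf hk
    filter_upwards [measurePreserving_resampleParam.quasiMeasurePreserving.ae centred] with z hz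
    exact hz
  pMoment_ne_top I := by
    have hm := (measurable_uncurry_freeze (N := N) (I := I) hf.measurable).enorm.pow_const p
    have finite : ∫⁻ w, ‖freeze f w.2 w.1.2 I w.1.1‖ₑ ^ p
        ∂(((iidLaw ℕ μ).prod ν).prod μ).prod (Measure.count : Measure (Fin N)) ≠ ∞ := by
      rw [lintegral_prod_symm _ hm.aemeasurable, lintegral_count, tsum_fintype]
      exact ENNReal.sum_ne_top.2 fun n _ =>
        pMoment_freeze_ne_top (n := n) (I := I) hp (hf.measurable _) (hf.pMoment_ne_top _)
    rwa [← measurePreserving_resampleParam.lintegral_comp hm] at finite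

theorem sum_predMoment_increment_le [SecondCountableTopology B] (hf : ∀ I, Measurable (f I))
    (x : ℕ → S) :
    ∑ k ∈ range N, predMoment μ p ν (increment f m) k x ≤
      maxStat p (resampleParam ν μ N) (resample f N) m N x := by
  refine le_of_eq_of_le ?_ (pMoment_le_maxStat le_rfl x)
  have hm : ∀ I, Measurable (resample f N I) := fun I => measurable_resample hf
  rw [pMoment_resampleParam (by fun_prop), sum_range]
  refine sum_congr rfl fun n _ => ?_
  simp only [predMoment, resample, sum_freeze n.2.le]

theorem condMoment_resample (hp : 0 < p) (hf : ∀ I, Measurable (f I)) (hAI : A ⊆ I) (x : ℕ → S) :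
    condMoment μ p (resampleParam ν μ N) A (resample f N I) x =
      ∑ n ∈ range N, if I ⊆ range n then condMoment μ p ν A (f (insert n I)) x else 0 := by
  have hm : Measurable (resample f N I) := measurable_resample hf
  have hmn : ∀ n : Fin N, Measurable fun z : (ℕ → S) × S =>
      pMoment p ν fun y => resample f N I (A.piecewise x z.1, ((y, z.2), n)) := fun n =>
    measurable_pMoment (by fun_prop)
  have term_eq : ∀ n : ℕ, ∫⁻ s, condMoment μ p ν A (freeze f n s I) x ∂μ =
      if I ⊆ range n then condMoment μ p ν A (f (insert n I)) x else 0 := by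
    intro n
    unfold freeze
    split_ifs with hI
    · exact lintegral_condMoment_update (fun h => notMem_range_self (hI (hAI h))) (hf _) x
    · simp only [condMoment, pMoment_zero hp, lintegral_zero]
  simp only [← term_eq]
  rw [condMoment, sum_range]
  simp only [fun w => pMoment_resampleParam (μ := μ) (ν := ν) (p := p)
    (g := fun y => resample f N I (A.piecewise x w, y)) (by fun_prop)]
  rw [lintegral_finsetSum _ fun n _ => (hmn n).lintegral_prod_right']
  exact sum_congr rfl fun n _ => lintegral_lintegral_swap (hmn n).aemeasurable

theorem condMomentSum_resample_le (hp : 0 < p) (hf : ∀ I, Measurable (f I)) (A : Finset ℕ)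
    (x : ℕ → S) :
    condMomentSum μ p (resampleParam ν μ N) (resample f N) m N A x ≤
      condMomentSum μ p ν f (m + 1) N A x := by
  calc condMomentSum μ p (resampleParam ν μ N) (resample f N) m N A x
      = ∑ I ∈ (range N).powersetCard m, ∑ n ∈ range N, if I ⊆ range n then
          if A ⊆ I then condMoment μ p ν A (f (insert n I)) x else 0 else 0 := by
        rw [condMomentSum, sum_filter]
        refine sum_congr rfl fun I _ => ?_
        split_ifs with hAI
        · exact condMoment_resample hp hf hAI x
        · simp only [ite_self, sum_const_zero]
    _ = ∑ n ∈ range N, ∑ I ∈ (range n).powersetCard m,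
          if A ⊆ I then condMoment μ p ν A (f (insert n I)) x else 0 := by
        rw [sum_comm]
        refine sum_congr rfl fun n hn => ?_
        rw [← sum_filter, filter_powersetCard_range (mem_range.1 hn).le]
    _ ≤ condMomentSum μ p ν f (m + 1) N A x := by
        rw [condMomentSum, sum_filter, sum_powersetCard_succ_range]
        refine sum_le_sum fun n _ => sum_le_sum fun I _ => ?_
        split_ifs with hAI hAI'
        · exact le_rfl
        · exact absurd (hAI.trans (subset_insert n I)) hAI'
        all_goals exact zero_le

end Resample

section MainInduction

variable {B : Type*} [NormedAddCommGroup B] [NormedSpace ℝ B] [MeasurableSpace B] {S Y : Type v}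
  [MeasurableSpace S] {μ : Measure S} [IsProbabilityMeasure μ] [MeasurableSpace Y] {ν : Measure Y}
  {p : ℝ} {f : Finset ℕ → (ℕ → S) × Y → B} {ψ : Seminorm ℝ B} {C : ℝ≥0}

theorem IsDegenerateFamily.maxStat_zero_le (hf : IsDegenerateFamily p μ ν f) (N : ℕ)
    (x : ℕ → S) : maxStat p ν f 0 N x ≤ condMomentSum μ p ν f 0 N ∅ x := by
  have const : ∀ x' y, f ∅ (x', y) = f ∅ (x, y) := fun x' y =>
    hf.dependsOn ∅ y fun i hi => absurd hi (notMem_empty i)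
  refine Finset.sup_le fun n _ => ?_
  simp only [condMomentSum, condMoment, powersetCard_zero, filter_singleton, if_true,
    sum_singleton, piecewise_empty, const, lintegral_const, measure_univ, mul_one, le_refl]

variable [CompleteSpace B] [SecondCountableTopology B] [BorelSpace B] [SFinite ν]

theorem IsDegenerateFamily.lintegral_truncRpow_maxStat_le (hf : IsDegenerateFamily p μ ν f)
    (hψ : IsTwoPointNorm p ψ C) (hp : 1 ≤ p) {κ : ℝ} (hκ : 0 < κ) (m N : ℕ) :
    ∫⁻ x, truncRpow κ (maxStat p ν f m N x) ∂iidLaw ℕ μ ≤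
      ((2 * maximalConst p C κ) ^ m : ℝ≥0) * ∑ A ∈ (range N).powerset,
        ∫⁻ x, truncRpow κ (condMomentSum μ p ν f m N A x) ∂iidLaw ℕ μ := by
  have hp0 : 0 < p := by linarith
  induction m generalizing Y N with
  | zero =>
    rw [pow_zero, ENNReal.coe_one, one_mul]
    exact (lintegral_mono fun x => truncRpow_mono hκ.le (hf.maxStat_zero_le N x)).trans
      (single_le_sum (f := fun A => ∫⁻ x, truncRpow κ (condMomentSum μ p ν f 0 N A x) ∂iidLaw ℕ μ)
        (fun _ _ => zero_le) (empty_mem_powerset _))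
  | succ m ih =>
    set K : ℝ≥0 := (2 * maximalConst p C κ) ^ m
    set c : Finset ℕ → ℝ≥0∞ := fun A =>
      ∫⁻ x, truncRpow κ (condMomentSum μ p ν f (m + 1) N A x) ∂iidLaw ℕ μ
    have increments : ∑ n ∈ range N,
        ∫⁻ x, truncRpow κ (pMoment p ν fun y => increment f m n (x, y)) ∂iidLaw ℕ μ ≤
        K * ∑ A ∈ (range N).powerset, c A := by
      rw [sum_powerset_range, mul_add, mul_sum]
      exact le_add_of_nonneg_of_le zero_le <| sum_le_sum fun n hn =>
        hf.lintegral_truncRpow_increment_le hp0 hκ.le (mem_range.1 hn) fun g hg => ih hg n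
    have predictable_variation : ∫⁻ x, truncRpow κ
        (∑ k ∈ range N, predMoment μ p ν (increment f m) k x) ∂iidLaw ℕ μ ≤
        K * ∑ A ∈ (range N).powerset, c A := by
      refine (lintegral_mono fun x => truncRpow_mono hκ.le
        (sum_predMoment_increment_le hf.measurable x)).trans ((ih (hf.resample hp0 N) N).trans ?_)
      gcongr with A
      exact lintegral_mono fun x =>
        truncRpow_mono hκ.le (condMomentSum_resample_le hp0 hf.measurable A x)
    calc ∫⁻ x, truncRpow κ (maxStat p ν f (m + 1) N x) ∂iidLaw ℕ μ
        = ∫⁻ x, truncRpow κ (maxMoment p ν (increment f m) N x) ∂iidLaw ℕ μ := by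
          simp only [maxMoment_increment]
      _ ≤ maximalConst p C κ * (K * ∑ A ∈ (range N).powerset, c A +
            K * ∑ A ∈ (range N).powerset, c A) :=
          ((hf.isMartingaleDiff_increment hp m).lintegral_truncRpow_maxMoment_le hψ hp hκ N).trans
            (mul_le_mul_right (add_le_add increments predictable_variation) _)
      _ = _ := by
          rw [show (2 * maximalConst p C κ) ^ (m + 1) = K * (2 * maximalConst p C κ) from
            pow_succ _ _]
          push_cast
          ring

end MainInduction

/-! ### Conditional expectations of functions of independent variables -/

section Reindexing

variable {ι α S : Type*} [MeasurableSpace S] (μ : Measure S) [IsProbabilityMeasure μ]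

theorem measurePreserving_comp_injective {a : α → ι} (ha : Injective a) :
    MeasurePreserving (fun (x : ι → S) i => x (a i)) (iidLaw ι μ) (iidLaw α μ) :=
  ⟨by fun_prop, Measure.map_infinitePi_infinitePi_of_inj ha⟩

theorem measurePreserving_updateFinset [DecidableEq ι] (J : Finset ι) :
    MeasurePreserving (fun z : (J → S) × (ι → S) => updateFinset z.2 J z.1)
      ((iidLaw J μ).prod (iidLaw ι μ)) (iidLaw ι μ) := by
  have restrict : MeasurePreserving (fun z : (ι → S) × (ι → S) => ((fun j : J => z.1 j), z.2))
      ((iidLaw ι μ).prod (iidLaw ι μ)) ((iidLaw J μ).prod (iidLaw ι μ)) :=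
    (measurePreserving_comp_injective μ Subtype.val_injective).prod (.id _)
  rw [← restrict.map_eq]
  refine MeasurePreserving.map_of_comp ?_ (measurable_updateFinset'.comp measurable_swap)
    restrict.measurable
  have splice : ∀ z : (ι → S) × (ι → S),
      updateFinset z.2 J (fun j => z.1 j) = J.piecewise z.1 z.2 := fun z => by
    ext i
    by_cases hi : i ∈ J <;> simp [updateFinset, hi]
  simpa only [comp_def, splice] using measurePreserving_piecewise μ J

end Reindexing

section Cylinders

variable {ι S : Type*} [DecidableEq ι]

theorem preimage_updateFinset_cylinder (J : Finset ι) (E : Set (J → S)) :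
    (fun z : (J → S) × (ι → S) => updateFinset z.2 J z.1) ⁻¹' cylinder J E = E ×ˢ Set.univ := by
  ext z
  have restrict_updateFinset : J.restrict (updateFinset z.2 J z.1) = z.1 := by
    ext j
    simp [updateFinset]
  simp [restrict_updateFinset]

variable [MeasurableSpace S] {μ : Measure S} [IsProbabilityMeasure μ]

theorem setLIntegral_cylinder (J : Finset ι) {E : Set (J → S)} (hE : MeasurableSet E)
    {F : (ι → S) → ℝ≥0∞} (hF : Measurable F) :
    ∫⁻ u in cylinder J E, F u ∂iidLaw ι μ =
      ∫⁻ z in E, ∫⁻ v, F (updateFinset v J z) ∂iidLaw ι μ ∂iidLaw J μ := by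
  have hsplice := measurePreserving_updateFinset μ J
  rw [← hsplice.setLIntegral_comp_preimage (hE.cylinder J) hF, preimage_updateFinset_cylinder,
    setLIntegral_prod (fun z => F (updateFinset z.2 J z.1))
      (hF.comp hsplice.measurable).aemeasurable, Measure.restrict_univ]

variable {B : Type*} [NormedAddCommGroup B] [NormedSpace ℝ B]

theorem setIntegral_comp_preimage {α β : Type*} [MeasurableSpace α] [MeasurableSpace β]
    {P : Measure α} {Q : Measure β} {X : α → β} (hX : MeasurePreserving X P Q) {E : Set β}
    (hE : MeasurableSet E) {g : β → B} (hg : AEStronglyMeasurable g Q) :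
    ∫ a in X ⁻¹' E, g (X a) ∂P = ∫ b in E, g b ∂Q := by
  rw [← hX.map_eq] at hg ⊢
  exact (setIntegral_map hE hg hX.aemeasurable).symm

theorem setIntegral_cylinder (J : Finset ι) {E : Set (J → S)} (hE : MeasurableSet E)
    {g : (ι → S) → B} (hg : Integrable g (iidLaw ι μ)) :
    ∫ u in cylinder J E, g u ∂iidLaw ι μ =
      ∫ z in E, ∫ v, g (updateFinset v J z) ∂iidLaw ι μ ∂iidLaw J μ := by
  have hsplice := measurePreserving_updateFinset μ J
  rw [← setIntegral_comp_preimage hsplice (hE.cylinder J) hg.aestronglyMeasurable,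
    preimage_updateFinset_cylinder, setIntegral_prod (fun z => g (updateFinset z.2 J z.1))
      (hsplice.integrable_comp_of_integrable hg).integrableOn, Measure.restrict_univ]

end Cylinders

section ConditionalExpectation

variable {Ω ι S : Type*} [MeasurableSpace Ω] [DecidableEq ι] [MeasurableSpace S] {P : Measure Ω}
  [IsFiniteMeasure P] {μ : Measure S} [IsProbabilityMeasure μ] {X : Ω → ι → S}

theorem condLExp_comp_ae_eq (hX : MeasurePreserving X P (iidLaw ι μ)) (J : Finset ι)
    {F : (ι → S) → ℝ≥0∞} (hF : Measurable F) :
    condLExp (MeasurableSpace.comap (fun ω (j : J) => X ω j) inferInstance) P (fun ω => F (X ω))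
      =ᵐ[P] fun ω => ∫⁻ v, F (updateFinset v J fun j => X ω j) ∂iidLaw ι μ := by
  have hXJ := (measurePreserving_comp_injective μ (Subtype.val_injective (p := (· ∈ J)))).comp hX
  have hsplice := measurePreserving_updateFinset μ J
  have measurable_integral : Measurable fun z : J → S =>
      ∫⁻ v, F (updateFinset v J z) ∂iidLaw ι μ :=
    (hF.comp hsplice.measurable).lintegral_prod_right'
  refine (ae_eq_condLExp hXJ.measurable.comap_le P _
    (measurable_integral.comp (comap_measurable _)) ?_).symm
  rintro _ ⟨E, hE, rfl⟩
  exact (hXJ.setLIntegral_comp_preimage hE measurable_integral).trans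
    ((setLIntegral_cylinder J hE hF).symm.trans
      (hX.setLIntegral_comp_preimage (hE.cylinder J) hF).symm)

variable {B : Type*} [NormedAddCommGroup B] [NormedSpace ℝ B] [CompleteSpace B]

theorem condExp_comp_ae_eq (hX : MeasurePreserving X P (iidLaw ι μ)) (J : Finset ι)
    {g : (ι → S) → B} (hg : StronglyMeasurable g) (hgi : Integrable g (iidLaw ι μ)) :
    P[fun ω => g (X ω) | MeasurableSpace.comap (fun ω (j : J) => X ω j) inferInstance]
      =ᵐ[P] fun ω => ∫ v, g (updateFinset v J fun j => X ω j) ∂iidLaw ι μ := by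
  have hXJ := (measurePreserving_comp_injective μ (Subtype.val_injective (p := (· ∈ J)))).comp hX
  have hsplice := measurePreserving_updateFinset μ J
  have stronglyMeasurable_integral : StronglyMeasurable fun z : J → S =>
      ∫ v, g (updateFinset v J z) ∂iidLaw ι μ :=
    (hg.comp_measurable hsplice.measurable).integral_prod_right'
  have integrable_integral : Integrable (fun z : J → S =>
      ∫ v, g (updateFinset v J z) ∂iidLaw ι μ) (iidLaw J μ) :=
    (hsplice.integrable_comp_of_integrable hgi).integral_prod_left
  refine (ae_eq_condExp_of_forall_setIntegral_eq hXJ.measurable.comap_le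
    (hX.integrable_comp_of_integrable hgi)
    (fun _ _ _ => (hXJ.integrable_comp_of_integrable integrable_integral).integrableOn) ?_
    (stronglyMeasurable_integral.comp_measurable
      (comap_measurable _)).aestronglyMeasurable).symm
  rintro _ ⟨E, hE, rfl⟩ -
  exact (setIntegral_comp_preimage hXJ hE
      stronglyMeasurable_integral.aestronglyMeasurable).trans
    ((setIntegral_cylinder J hE hgi).symm.trans
      (setIntegral_comp_preimage hX (hE.cylinder J) hg.aestronglyMeasurable).symm)

end ConditionalExpectation

section IID

variable {Ω S : Type*} [MeasurableSpace Ω] [MeasurableSpace S] {ξ : ℕ → Ω → S} {P : Measure Ω}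

theorem IsIID.measurePreserving (hξ : IsIID ξ P) :
    MeasurePreserving (fun ω i => ξ i ω) P (iidLaw ℕ (P.map (ξ 0))) := by
  refine ⟨measurable_pi_iff.2 hξ.measurable, ?_⟩
  rw [hξ.indep.map_fun_eq_infinitePi_map hξ.measurable]
  congr 1
  funext i
  exact (hξ.identDistrib i).map_eq

variable [IsProbabilityMeasure P]

theorem IsIID.isProbabilityMeasure_map (hξ : IsIID ξ P) : IsProbabilityMeasure (P.map (ξ 0)) :=
  Measure.isProbabilityMeasure_map (hξ.measurable 0).aemeasurable

theorem IsIID.measurePreserving_firstTerms (hξ : IsIID ξ P) (m : ℕ) :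
    MeasurePreserving (firstTerms m ξ) P (iidLaw (Fin m) (P.map (ξ 0))) :=
  have := hξ.isProbabilityMeasure_map
  (measurePreserving_comp_injective (P.map (ξ 0)) Fin.val_injective).comp hξ.measurePreserving

variable {B : Type*} [NormedAddCommGroup B] [NormedSpace ℝ B] [CompleteSpace B]

theorem IsDegenerate.ae_integral_update_eq_zero {m : ℕ} {g : (Fin m → S) → B}
    (hd : IsDegenerate g ξ P) (hξ : IsIID ξ P) (hg : StronglyMeasurable g) (l : Fin m) :
    ∀ᵐ u ∂iidLaw (Fin m) (P.map (ξ 0)), ∫ s, g (update u l s) ∂P.map (ξ 0) = 0 := by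
  have := hξ.isProbabilityMeasure_map
  have hX := hξ.measurePreserving_firstTerms m
  have hgi : Integrable g (iidLaw (Fin m) (P.map (ξ 0))) :=
    (hX.integrable_comp hg.aestronglyMeasurable).1 hd.integrable
  have integral_eval : ∀ u : Fin m → S,
      ∫ v, g (updateFinset v (univ.erase l) fun j => u j) ∂iidLaw (Fin m) (P.map (ξ 0)) =
        ∫ s, g (update u l s) ∂P.map (ξ 0) := fun u => by
    have splice : ∀ v, updateFinset v (univ.erase l) (fun j => u j) = update u l (v l) :=
      fun v => by
        ext i
        by_cases hi : i = l
        · subst hi; simp [updateFinset]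
        · simp [updateFinset, hi]
    have heval := measurePreserving_eval_infinitePi (fun _ : Fin m => P.map (ξ 0)) l
    simp only [splice]
    conv_rhs => rw [← heval.map_eq]
    exact (integral_map heval.aemeasurable
      (hg.comp_measurable (measurable_update u)).aestronglyMeasurable).symm
  have stronglyMeasurable_integral : StronglyMeasurable fun u : Fin m → S =>
      ∫ s, g (update u l s) ∂P.map (ξ 0) :=
    (hg.comp_measurable (by fun_prop : Measurable fun z : (Fin m → S) × S =>
      update z.1 l z.2)).integral_prod_right'
  rw [← hX.map_eq, ae_map_iff hX.aemeasurable
    (stronglyMeasurable_integral.measurableSet_eq_fun stronglyMeasurable_const)]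
  filter_upwards [condExp_comp_ae_eq hX (univ.erase l) hg hgi, hd.condExp_eq_zero l] with ω h h'
  rw [← integral_eval, ← h]
  exact h'

end IID

/-! ### Increasing tuples and finite sets -/

section Tuples

variable {m n N : ℕ}

theorem mem_inc {i : Fin m → ℕ} : i ∈ inc m n ↔ (∀ l, i l < n) ∧ StrictMono i := by
  simp [inc, Fintype.mem_piFinset]

/-- The increasing enumeration of a set with `m` elements. For sets of other cardinalities the
value is the tuple `(0, …, m - 1)`, so that the enumeration is always increasing. -/
noncomputable def enum (m : ℕ) (I : Finset ℕ) : Fin m → ℕ :=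
  if h : #I = m then I.orderEmbOfFin h else fun l => l

theorem enum_strictMono (I : Finset ℕ) : StrictMono (enum m I) := by
  unfold enum
  split_ifs with h
  · exact (I.orderEmbOfFin h).strictMono
  · exact Fin.val_strictMono

theorem image_enum {I : Finset ℕ} (h : #I = m) : univ.image (enum m I) = I := by
  rw [enum, dif_pos h, image_orderEmbOfFin_univ]

theorem enum_mem {I : Finset ℕ} (h : #I = m) (l : Fin m) : enum m I l ∈ I := by
  rw [enum, dif_pos h]
  exact orderEmbOfFin_mem I h l

theorem card_image_of_strictMono {i : Fin m → ℕ} (hi : StrictMono i) : #(univ.image i) = m := by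
  rw [card_image_of_injective _ hi.injective, card_univ, Fintype.card_fin]

theorem enum_image {i : Fin m → ℕ} (hi : StrictMono i) : enum m (univ.image i) = i := by
  rw [enum, dif_pos (card_image_of_strictMono hi)]
  exact (orderEmbOfFin_unique _ (fun l => mem_image_of_mem i (mem_univ l)) hi).symm

theorem sum_inc {M : Type*} [AddCommMonoid M] (F : (Fin m → ℕ) → M) :
    ∑ i ∈ inc m n, F i = ∑ I ∈ (range n).powersetCard m, F (enum m I) := by
  refine sum_nbij' (fun i => univ.image i) (enum m) (fun i hi => ?_) (fun I hI => ?_)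
    (fun i hi => enum_image (mem_inc.1 hi).2) (fun I hI => image_enum (mem_powersetCard.1 hI).2)
    (fun i hi => by rw [enum_image (mem_inc.1 hi).2])
  · rw [mem_inc] at hi
    exact mem_powersetCard.2 ⟨image_subset_iff.2 fun l _ => mem_range.2 (hi.1 l),
      card_image_of_strictMono hi.2⟩
  · rw [mem_powersetCard] at hI
    exact mem_inc.2 ⟨fun l => mem_range.1 (hI.1 (enum_mem hI.2 l)), enum_strictMono I⟩

open Classical in
/-- The increasing assignments of indices in `{0, …, N - 1}` to the positions in some
`J ⊆ {0, …, m - 1}`. -/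
noncomputable def placements (N : ℕ) (J : Finset (Fin m)) : Finset (J → ℕ) :=
  {a ∈ Fintype.piFinset fun _ : J => range N | StrictMono a}

theorem mem_placements {J : Finset (Fin m)} {a : J → ℕ} :
    a ∈ placements N J ↔ (∀ j, a j < N) ∧ StrictMono a := by
  simp [placements, Fintype.mem_piFinset]

theorem card_filter_image_eq_le (A : Finset ℕ) :
    #{s ∈ univ.sigma fun J : Finset (Fin m) => placements N J | univ.image s.2 = A} ≤ 2 ^ m := by
  refine (card_le_card_of_injOn (t := univ) Sigma.fst (fun _ _ => mem_univ _) ?_).trans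
    (by simp)
  rintro ⟨J, a⟩ ha ⟨_, b⟩ hb rfl
  simp only [coe_filter, mem_sigma, mem_univ, true_and, Set.mem_ofPred_eq, mem_placements]
    at ha hb
  have same_range : Set.range a = Set.range b := by
    simpa using congrArg ((↑) : Finset ℕ → Set ℕ) (ha.2.trans hb.2.symm)
  rw [(ha.1.2.range_inj hb.1.2).1 same_range]

end Tuples

/-! ### Families of kernels -/

section KernelFamily

variable {B S Y : Type*} [NormedAddCommGroup B] {m N : ℕ} {h : (Fin m → ℕ) → (Fin m → S) → B}

/-- The family indexed by finite sets that is given by a family of kernels indexed by increasing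
tuples in `{0, …, N - 1}`. -/
noncomputable def kernelFamily (N : ℕ) (h : (Fin m → ℕ) → (Fin m → S) → B) (I : Finset ℕ)
    (z : (ℕ → S) × Y) : B :=
  if I ∈ (range N).powersetCard m then h (enum m I) fun l => z.1 (enum m I l) else 0

theorem sum_kernelFamily {n : ℕ} (hn : n ≤ N) (z : (ℕ → S) × Y) :
    ∑ I ∈ (range n).powersetCard m, kernelFamily N h I z =
      ∑ i ∈ inc m n, h i fun l => z.1 (i l) := by
  rw [sum_inc fun i => h i fun l => z.1 (i l)]
  exact sum_congr rfl fun I hI => if_pos (powersetCard_mono (range_mono hn) hI)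

variable [MeasurableSpace S] {μ : Measure S} {p : ℝ}

/-- The conditional `p`-th moment of the kernel `h i` given that its arguments at the positions in
`J` are `z`, summed over all `i` whose indices at these positions are `a`. -/
noncomputable def kernelMomentSum (μ : Measure S) (p : ℝ) (h : (Fin m → ℕ) → (Fin m → S) → B)
    (N : ℕ) (J : Finset (Fin m)) (a : J → ℕ) (z : J → S) : ℝ≥0∞ :=
  ∑ i ∈ inc m N with ∀ j : J, i j = a j,
    pMoment p (iidLaw (Fin m) μ) fun v => h i (updateFinset v J z)

variable [MeasurableSpace B] [MeasurableSpace Y] {ν : Measure Y}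

theorem measurable_kernelFamily (hh : ∀ i, StrictMono i → Measurable (h i)) (I : Finset ℕ) :
    Measurable (kernelFamily N h I : (ℕ → S) × Y → B) := by
  unfold kernelFamily
  split_ifs
  · exact (hh _ (enum_strictMono I)).comp (by fun_prop)
  · exact measurable_const

variable [IsProbabilityMeasure μ] [IsProbabilityMeasure ν]

theorem pMoment_comp_injective [OpensMeasurableSpace B] {g : (Fin m → S) → B} (hg : Measurable g)
    {i : Fin m → ℕ} (hi : Injective i) :
    pMoment p (iidLaw ℕ μ) (fun x => g fun l => x (i l)) = pMoment p (iidLaw (Fin m) μ) g :=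
  (measurePreserving_comp_injective μ hi).lintegral_comp (hg.enorm.pow_const p)

theorem condMoment_kernelFamily [OpensMeasurableSpace B]
    (hh : ∀ i, StrictMono i → Measurable (h i)) {I : Finset ℕ}
    (hI : I ∈ (range N).powersetCard m) (A : Finset ℕ) (x : ℕ → S) :
    condMoment μ p ν A (kernelFamily N h I) x =
      pMoment p (iidLaw (Fin m) μ) fun v => h (enum m I)
        (updateFinset v {l | enum m I l ∈ A} fun j => x (enum m I j)) := by
  have splice : ∀ w : ℕ → S, (fun l => A.piecewise x w (enum m I l)) =
      updateFinset (fun l => w (enum m I l)) {l | enum m I l ∈ A} fun j => x (enum m I j) :=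
    fun w => by
      ext l
      by_cases hl : enum m I l ∈ A <;> simp [updateFinset, hl]
  simp only [condMoment, kernelFamily, if_pos hI, splice, pMoment, lintegral_const, measure_univ,
    mul_one]
  exact pMoment_comp_injective ((hh _ (enum_strictMono I)).comp measurable_updateFinset_left)
    (enum_strictMono I).injective

theorem condMomentSum_kernelFamily [OpensMeasurableSpace B]
    (hh : ∀ i, StrictMono i → Measurable (h i)) (A : Finset ℕ) (x : ℕ → S) :
    condMomentSum μ p ν (kernelFamily N h) m N A x =
      ∑ i ∈ inc m N with A ⊆ univ.image i, pMoment p (iidLaw (Fin m) μ) fun v => h i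
        (updateFinset v {l | i l ∈ A} fun j => x (i j)) := by
  rw [condMomentSum, sum_filter, sum_filter, sum_inc]
  refine sum_congr rfl fun I hI => ?_
  rw [image_enum (mem_powersetCard.1 hI).2, condMoment_kernelFamily hh hI]

theorem condMomentSum_kernelFamily_le [OpensMeasurableSpace B]
    (hh : ∀ i, StrictMono i → Measurable (h i)) (A : Finset ℕ) (x : ℕ → S) :
    condMomentSum μ p ν (kernelFamily N h) m N A x ≤
      ∑ s ∈ univ.sigma fun J : Finset (Fin m) => placements N J with univ.image s.2 = A,
        kernelMomentSum μ p h N s.1 s.2 fun j => x (s.2 j) := by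
  set placement : (Fin m → ℕ) → Σ J : Finset (Fin m), J → ℕ := fun i =>
    ⟨univ.filter fun l => i l ∈ A, fun j => i j⟩
  rw [condMomentSum_kernelFamily hh, ← sum_fiberwise_of_maps_to (g := placement)]
  · refine sum_le_sum fun s _ => ?_
    calc _ = ∑ i ∈ {i ∈ inc m N | A ⊆ univ.image i} with placement i = s,
          pMoment p (iidLaw (Fin m) μ) fun v => h i (updateFinset v s.1 fun j => x (s.2 j)) :=
          sum_congr rfl fun i hi => by
            obtain rfl := (mem_filter.1 hi).2
            rfl
      _ ≤ _ := sum_le_sum_of_subset fun i hi => by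
          simp only [mem_filter] at hi ⊢
          obtain ⟨⟨hi, -⟩, rfl⟩ := hi
          exact ⟨hi, fun _ => rfl⟩
  · intro i hi
    rw [mem_filter, mem_inc] at hi
    obtain ⟨⟨bound, mono⟩, hA⟩ := hi
    refine mem_filter.2 ⟨mem_sigma.2 ⟨mem_univ _, mem_placements.2
      ⟨fun j => bound j, fun j j' hj => mono hj⟩⟩, ?_⟩
    ext k
    simp only [placement, mem_image, mem_univ, true_and, Subtype.exists, mem_filter,
      exists_prop]
    refine ⟨by rintro ⟨l, hl, rfl⟩; exact hl, fun hk => ?_⟩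
    obtain ⟨l, -, rfl⟩ := mem_image.1 (hA hk)
    exact ⟨l, hk, rfl⟩

theorem measurable_kernelMomentSum [OpensMeasurableSpace B]
    (hh : ∀ i, StrictMono i → Measurable (h i)) (J : Finset (Fin m)) (a : J → ℕ) :
    Measurable (kernelMomentSum μ p h N J a) := by
  refine Finset.measurable_sum _ fun i hi => ?_
  have := hh i (mem_inc.1 (mem_filter.1 hi).1).2
  exact Measurable.lintegral_prod_right' (f := fun z : (J → S) × (Fin m → S) =>
    ‖h i (updateFinset z.2 J z.1)‖ₑ ^ p)
    ((this.comp (measurable_updateFinset'.comp measurable_swap)).enorm.pow_const p)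

theorem lintegral_truncRpow_condMomentSum_kernelFamily_le [OpensMeasurableSpace B]
    (hh : ∀ i, StrictMono i → Measurable (h i)) {κ : ℝ} (hκ : 0 < κ) (A : Finset ℕ) :
    ∫⁻ x, truncRpow κ (condMomentSum μ p ν (kernelFamily N h) m N A x) ∂iidLaw ℕ μ ≤
      (2 ^ m : ℝ≥0∞) ^ κ *
        ∑ s ∈ univ.sigma fun J : Finset (Fin m) => placements N J with univ.image s.2 = A,
          ∫⁻ z, truncRpow κ (kernelMomentSum μ p h N s.1 s.2 z) ∂iidLaw s.1 μ := by
  set sites := {s ∈ univ.sigma fun J : Finset (Fin m) => placements N J | univ.image s.2 = A}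
  have hmeas : ∀ s : Σ J : Finset (Fin m), J → ℕ, Measurable fun z =>
      truncRpow κ (kernelMomentSum μ p h N s.1 s.2 z) := fun s =>
    measurable_truncRpow (measurable_kernelMomentSum hh s.1 s.2)
  have hcard : (#sites : ℝ≥0∞) ≤ 2 ^ m := by exact_mod_cast card_filter_image_eq_le A
  calc _ ≤ ∫⁻ x, (2 ^ m : ℝ≥0∞) ^ κ * ∑ s ∈ sites,
          truncRpow κ (kernelMomentSum μ p h N s.1 s.2 fun j => x (s.2 j)) ∂iidLaw ℕ μ := by
        refine lintegral_mono fun x => ?_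
        exact (truncRpow_mono hκ.le (condMomentSum_kernelFamily_le hh A x)).trans
          ((truncRpow_sum_le hκ _ _).trans (by gcongr))
    _ = (2 ^ m : ℝ≥0∞) ^ κ * ∑ s ∈ sites, ∫⁻ x,
          truncRpow κ (kernelMomentSum μ p h N s.1 s.2 fun j => x (s.2 j)) ∂iidLaw ℕ μ := by
        have hcomp : ∀ s : Σ J : Finset (Fin m), J → ℕ, Measurable fun x : ℕ → S =>
            truncRpow κ (kernelMomentSum μ p h N s.1 s.2 fun j => x (s.2 j)) := fun s =>
          (hmeas s).comp (by fun_prop)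
        rw [lintegral_const_mul _ (Finset.measurable_sum _ fun s _ => hcomp s),
          lintegral_finsetSum _ fun s _ => hcomp s]
    _ = _ := by
        congr 1
        refine sum_congr rfl fun s hs => ?_
        have inj : Injective s.2 :=
          (mem_placements.1 (mem_sigma.1 (mem_filter.1 hs).1).2).2.injective
        exact (measurePreserving_comp_injective μ inj).lintegral_comp (hmeas s)

theorem sum_lintegral_truncRpow_condMomentSum_kernelFamily_le [OpensMeasurableSpace B]
    (hh : ∀ i, StrictMono i → Measurable (h i)) {κ : ℝ} (hκ : 0 < κ) :
    ∑ A ∈ (range N).powerset,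
        ∫⁻ x, truncRpow κ (condMomentSum μ p ν (kernelFamily N h) m N A x) ∂iidLaw ℕ μ ≤
      (2 ^ m : ℝ≥0∞) ^ κ * ∑ J : Finset (Fin m), ∑ a ∈ placements N J,
        ∫⁻ z, truncRpow κ (kernelMomentSum μ p h N J a z) ∂iidLaw J μ := by
  set L : (Σ J : Finset (Fin m), J → ℕ) → ℝ≥0∞ := fun s =>
    ∫⁻ z, truncRpow κ (kernelMomentSum μ p h N s.1 s.2 z) ∂iidLaw s.1 μ
  have maps_to : ∀ s ∈ univ.sigma fun J : Finset (Fin m) => placements N J,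
      univ.image s.2 ∈ (range N).powerset := fun s hs => by
    rw [mem_powerset, image_subset_iff]
    exact fun j _ => mem_range.2 ((mem_placements.1 (mem_sigma.1 hs).2).1 j)
  refine (sum_le_sum fun A _ =>
    lintegral_truncRpow_condMomentSum_kernelFamily_le hh hκ A).trans_eq ?_
  rw [← mul_sum, sum_fiberwise_of_maps_to maps_to L, sum_sigma]

theorem isDegenerateFamily_kernelFamily [NormedSpace ℝ B] [OpensMeasurableSpace B]
    (hp : 0 < p) (hh : ∀ i, StrictMono i → Measurable (h i))
    (hmoment : ∀ i ∈ inc m N, pMoment p (iidLaw (Fin m) μ) (h i) ≠ ∞)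
    (hcentred : ∀ i, StrictMono i → ∀ l, ∀ᵐ u ∂iidLaw (Fin m) μ,
      ∫ s, h i (update u l s) ∂μ = 0) :
    IsDegenerateFamily p μ ν (kernelFamily N h) where
  measurable := measurable_kernelFamily hh
  dependsOn I y x x' hx := by
    simp only [kernelFamily]
    split_ifs with hI
    · exact congrArg (h _) (funext fun l => hx _ (enum_mem (mem_powersetCard.1 hI).2 l))
    · rfl
  integral_update I k hk := by
    by_cases hI : I ∈ (range N).powersetCard m
    · obtain ⟨l, -, rfl⟩ := mem_image.1 ((image_enum (mem_powersetCard.1 hI).2).symm ▸ hk)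
      have inj : Injective (enum m I) := (enum_strictMono I).injective
      have centred := (measurePreserving_comp_injective μ inj).quasiMeasurePreserving.ae
        (hcentred _ (enum_strictMono I) l)
      filter_upwards [Measure.quasiMeasurePreserving_fst.ae centred] with z hz
      rw [← hz]
      refine integral_congr_ae (.of_forall fun s => ?_)
      simp only [kernelFamily, if_pos hI]
      exact congrArg (h _) (Function.update_comp_eq_of_injective _ inj _ _)
    · simp only [kernelFamily, if_neg hI, integral_zero, Filter.eventually_true]
  pMoment_ne_top I := by
    by_cases hI : I ∈ (range N).powersetCard m
    · have hi : enum m I ∈ inc m N := mem_inc.2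
        ⟨fun l => mem_range.1 ((mem_powersetCard.1 hI).1 (enum_mem (mem_powersetCard.1 hI).2 l)),
          enum_strictMono I⟩
      have inj : Injective (enum m I) := (enum_strictMono I).injective
      have law := (measurePreserving_comp_injective μ inj).comp
        (measurePreserving_fst (μ := iidLaw ℕ μ) (ν := ν))
      rw [show kernelFamily N h I = fun z : (ℕ → S) × Y => h (enum m I) fun l =>
        z.1 (enum m I l) from funext fun z => if_pos hI]
      exact (law.lintegral_comp ((hh _ (enum_strictMono I)).enorm.pow_const p)).trans_ne
        (hmoment _ hi)
    · have vanishes : (kernelFamily N h I : (ℕ → S) × Y → B) = fun _ => 0 :=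
        funext fun z => if_neg hI
      simp [vanishes, pMoment, hp]

end KernelFamily

/-! ### Tails of `U`-statistics -/

theorem sum_finset_eq_univ_add_proper_add_empty {ι M : Type*} [Fintype ι] [DecidableEq ι]
    [Nonempty ι] [AddCommMonoid M] (F : Finset ι → M) :
    ∑ J, F J = F univ + ∑ J : Finset ι with J.Nonempty ∧ J ≠ univ, F J + F ∅ := by
  have improper : univ.filter (fun J : Finset ι => ¬(J.Nonempty ∧ J ≠ univ)) = {univ, ∅} := by
    ext J
    simp only [mem_filter, mem_univ, true_and, mem_insert, mem_singleton, nonempty_iff_ne_empty]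
    tauto
  rw [← sum_filter_not_add_sum_filter univ fun J : Finset ι => J.Nonempty ∧ J ≠ univ, improper,
    sum_pair univ_nonempty.ne_empty, add_right_comm]

section KernelMomentSum

variable {B S : Type*} [NormedAddCommGroup B] [MeasurableSpace S] {m N : ℕ}
  {h : (Fin m → ℕ) → (Fin m → S) → B} {μ : Measure S} {p : ℝ}

theorem kernelMomentSum_smul [NormedSpace ℝ B] (hp : 0 ≤ p) {c : ℝ} (J : Finset (Fin m))
    (a : J → ℕ) (z : J → S) :
    kernelMomentSum μ p (fun i u => c • h i u) N J a z =
      ‖c‖ₑ ^ p * kernelMomentSum μ p h N J a z := by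
  have hc : ‖c‖ₑ ^ p ≠ ∞ := ENNReal.rpow_ne_top_of_nonneg hp enorm_ne_top
  simp only [kernelMomentSum, pMoment, enorm_smul, ENNReal.mul_rpow_of_nonneg _ _ hp,
    lintegral_const_mul' _ _ hc, mul_sum]

theorem kernelMomentSum_univ [IsProbabilityMeasure μ] {i : Fin m → ℕ} (hi : i ∈ inc m N)
    (z : ↥(univ : Finset (Fin m)) → S) :
    kernelMomentSum μ p h N univ (fun j => i j) z = ‖h i fun l => z ⟨l, mem_univ l⟩‖ₑ ^ p := by
  have unique : {i' ∈ inc m N | ∀ j : ↥(univ : Finset (Fin m)), i' j = i j} = {i} := by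
    ext i'
    simp only [mem_filter, mem_singleton]
    refine ⟨fun h => funext fun l => h.2 ⟨l, mem_univ l⟩, ?_⟩
    rintro rfl
    exact ⟨hi, fun _ => rfl⟩
  simp only [kernelMomentSum, unique, sum_singleton, updateFinset_univ, pMoment, lintegral_const,
    measure_univ, mul_one]

theorem kernelMomentSum_empty (a : (∅ : Finset (Fin m)) → ℕ) (z : (∅ : Finset (Fin m)) → S) :
    kernelMomentSum μ p h N ∅ a z = ∑ i ∈ inc m N, pMoment p (iidLaw (Fin m) μ) (h i) := by
  rw [kernelMomentSum, filter_true_of_mem fun i _ j => (notMem_empty _ j.2).elim]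
  simp only [updateFinset_empty]

end KernelMomentSum

theorem tailIntegral_congr_ae {Ω : Type*} [MeasurableSpace Ω] {P : Measure Ω} {q t : ℝ}
    {Y Z : Ω → ℝ≥0∞} (h : Y =ᵐ[P] Z) : tailIntegral P q t Y = tailIntegral P q t Z := by
  have tail : ∀ s, P {ω | s < Y ω} = P {ω | s < Z ω} := fun s =>
    measure_congr (h.mono fun ω hω => congrArg (s < ·) hω)
  simp only [tailIntegral, tail]

section Tails

variable {Ω S B : Type*} [MeasurableSpace Ω] {P : Measure Ω} [IsProbabilityMeasure P]
  [MeasurableSpace S] {ξ : ℕ → Ω → S} [NormedAddCommGroup B] [MeasurableSpace B]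
  {m N : ℕ} {h : (Fin m → ℕ) → (Fin m → S) → B} {p q t : ℝ}

theorem IsIID.pMoment_eq [OpensMeasurableSpace B] (hξ : IsIID ξ P) {g : (Fin m → S) → B}
    (hg : Measurable g) :
    pMoment p (iidLaw (Fin m) (P.map (ξ 0))) g = ∫⁻ ω, ‖g (firstTerms m ξ ω)‖ₑ ^ p ∂P :=
  ((hξ.measurePreserving_firstTerms m).lintegral_comp (hg.enorm.pow_const p)).symm

theorem IsIID.condMomentRoot_ae_eq [OpensMeasurableSpace B] (hξ : IsIID ξ P)
    (hh : ∀ i, StrictMono i → Measurable (h i)) (J : Finset (Fin m)) (a : J → ℕ) :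
    condMomentRoot P h ξ p N J a =ᵐ[P] fun ω =>
      kernelMomentSum (P.map (ξ 0)) p h N J a (fun j => firstTerms m ξ ω j) ^ (1 / p) := by
  have := hξ.isProbabilityMeasure_map
  have summand : ∀ i ∈ inc m N,
      condLExp (sigmaAlg ξ J) P (fun ω => ‖h i (firstTerms m ξ ω)‖ₑ ^ p) =ᵐ[P] fun ω =>
        pMoment p (iidLaw (Fin m) (P.map (ξ 0))) fun v =>
          h i (updateFinset v J fun j => firstTerms m ξ ω j) := fun i hi =>
    condLExp_comp_ae_eq (hξ.measurePreserving_firstTerms m) J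
      ((hh i (mem_inc.1 hi).2).enorm.pow_const p)
  filter_upwards [(Filter.eventually_all_finset (inc m N)).2 summand] with ω hω
  rw [condMomentRoot, kernelMomentSum]
  exact congrArg (· ^ (1 / p)) (sum_congr rfl fun i hi => hω i (mem_filter.1 hi).1)

theorem IsIID.lintegral_truncRpow_kernelMomentSum_smul [NormedSpace ℝ B] [OpensMeasurableSpace B]
    (hξ : IsIID ξ P) (hh : ∀ i, StrictMono i → Measurable (h i)) (hp : 0 < p) (hq : 0 < q)
    (ht : 0 < t) (J : Finset (Fin m)) (a : J → ℕ) :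
    ∫⁻ z, truncRpow (q / p) (kernelMomentSum (P.map (ξ 0)) p (fun i u => t⁻¹ • h i u) N J a z)
        ∂iidLaw J (P.map (ξ 0)) =
      ENNReal.ofReal q * tailIntegral P q t (condMomentRoot P h ξ p N J a) := by
  have := hξ.isProbabilityMeasure_map
  have hXJ := (measurePreserving_comp_injective (P.map (ξ 0))
    (Subtype.val_injective (p := (· ∈ J)))).comp (hξ.measurePreserving_firstTerms m)
  have hroot := hξ.condMomentRoot_ae_eq (p := p) (N := N) hh J a
  have hmeas := measurable_kernelMomentSum (N := N) (μ := P.map (ξ 0)) (p := p) hh J a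
  have rescale : ∀ w : ℝ≥0∞, truncRpow (q / p) (‖t⁻¹‖ₑ ^ p * w) =
      truncRpow q (w ^ (1 / p) / ENNReal.ofReal t) := fun w => by
    have power : (w ^ (1 / p) / ENNReal.ofReal t) ^ p = ‖t⁻¹‖ₑ ^ p * w := by
      rw [enorm_inv ht.ne', Real.enorm_of_nonneg ht.le, ENNReal.div_rpow_of_nonneg _ _ hp.le,
        ← ENNReal.rpow_mul, one_div_mul_cancel hp.ne', ENNReal.rpow_one, ENNReal.inv_rpow,
        ENNReal.div_eq_inv_mul]
    rw [← power, truncRpow_rpow hp, mul_div_cancel₀ _ hp.ne']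
  rw [← lintegral_truncRpow P hq ht (((hmeas.pow_const (1 / p)).comp
    hXJ.measurable).aemeasurable.congr hroot.symm)]
  calc _ = ∫⁻ z, truncRpow q (kernelMomentSum (P.map (ξ 0)) p h N J a z ^ (1 / p) /
        ENNReal.ofReal t) ∂iidLaw J (P.map (ξ 0)) := by
        simp only [kernelMomentSum_smul hp.le, rescale]
    _ = ∫⁻ ω, truncRpow q (kernelMomentSum (P.map (ξ 0)) p h N J a
        (fun j => firstTerms m ξ ω j) ^ (1 / p) / ENNReal.ofReal t) ∂P :=
        (hXJ.lintegral_comp (by fun_prop)).symm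
    _ = _ := lintegral_congr_ae (hroot.mono fun ω hω => by simp only [hω])

theorem sum_tailIntegral_condMomentRoot_univ [OpensMeasurableSpace B] (hξ : IsIID ξ P)
    (hh : ∀ i, StrictMono i → Measurable (h i)) (hp : 0 < p) :
    ∑ a ∈ placements N univ, tailIntegral P q t (condMomentRoot P h ξ p N univ a) =
      ∑ i ∈ inc m N, tailIntegral P q t fun ω => ‖h i (firstTerms m ξ ω)‖ₑ := by
  have := hξ.isProbabilityMeasure_map
  refine (sum_bij (fun i _ (j : ↥(univ : Finset (Fin m))) => i j) (fun i hi => ?_)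
    (fun i _ i' _ h => ?_) (fun a ha => ?_) fun i hi => tailIntegral_congr_ae ?_).symm
  · rw [mem_inc] at hi
    exact mem_placements.2 ⟨fun j => hi.1 j, fun j j' hj => hi.2 hj⟩
  · exact funext fun l => congrFun h ⟨l, mem_univ l⟩
  · rw [mem_placements] at ha
    exact ⟨fun l => a ⟨l, mem_univ l⟩, mem_inc.2 ⟨fun l => ha.1 _, fun l l' hl => ha.2 hl⟩, rfl⟩
  · filter_upwards [hξ.condMomentRoot_ae_eq (p := p) (N := N) hh univ fun j => i j] with ω hω
    rw [hω, kernelMomentSum_univ hi, ← ENNReal.rpow_mul, mul_one_div_cancel hp.ne',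
      ENNReal.rpow_one]

theorem sum_tailIntegral_condMomentRoot_empty_le [OpensMeasurableSpace B] (hξ : IsIID ξ P)
    (hh : ∀ i, StrictMono i → Measurable (h i)) (hq : 0 < q) (ht : 0 < t) :
    ENNReal.ofReal q *
        ∑ a ∈ placements N ∅, tailIntegral P q t (condMomentRoot P h ξ p N ∅ a) ≤
      ENNReal.ofReal t ^ (-q) *
        (∑ i ∈ inc m N, ∫⁻ ω, ‖h i (firstTerms m ξ ω)‖ₑ ^ p ∂P) ^ (q / p) := by
  have := hξ.isProbabilityMeasure_map
  set M := ∑ i ∈ inc m N, ∫⁻ ω, ‖h i (firstTerms m ξ ω)‖ₑ ^ p ∂P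
  have root_eq : ∀ a, condMomentRoot P h ξ p N ∅ a =ᵐ[P] fun _ => M ^ (1 / p) := fun a => by
    filter_upwards [hξ.condMomentRoot_ae_eq hh ∅ a] with ω hω
    rw [hω, kernelMomentSum_empty,
      sum_congr rfl fun i hi => hξ.pMoment_eq (hh i (mem_inc.1 hi).2)]
  have card_le : #(placements (m := m) N ∅) ≤ 1 := card_le_one_of_subsingleton _
  calc _ = #(placements (m := m) N ∅) *
        ∫⁻ _, truncRpow q (M ^ (1 / p) / ENNReal.ofReal t) ∂P := by
        rw [sum_congr rfl fun a _ => tailIntegral_congr_ae (root_eq a), sum_const, nsmul_eq_mul,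
          mul_left_comm, lintegral_truncRpow P hq ht aemeasurable_const]
    _ ≤ 1 * ∫⁻ _, truncRpow q (M ^ (1 / p) / ENNReal.ofReal t) ∂P := by
        gcongr
        exact_mod_cast card_le
    _ ≤ (M ^ (1 / p) / ENNReal.ofReal t) ^ q := by
        rw [one_mul, lintegral_const, measure_univ, mul_one]
        exact truncRpow_le_rpow hq.le _
    _ = _ := by
        rw [ENNReal.div_rpow_of_nonneg _ _ hq.le, ← ENNReal.rpow_mul, one_div_mul_eq_div,
          ENNReal.rpow_neg, ENNReal.div_eq_inv_mul]

theorem measure_lt_sup_uStat_le_lintegral [NormedSpace ℝ B] [BorelSpace B]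
    [SecondCountableTopology B] (hξ : IsIID ξ P) (hh : ∀ i, StrictMono i → Measurable (h i))
    (hp : 0 < p) (ht : 0 < t) (κ : ℝ) (N : ℕ) :
    P {ω | t < (((Icc m N).sup fun n => ‖uStat h ξ n ω‖₊ : ℝ≥0) : ℝ)} ≤
      ∫⁻ x, truncRpow κ (maxStat p (.dirac PUnit.unit)
        (kernelFamily N fun i u => t⁻¹ • h i u) m N x) ∂iidLaw ℕ (P.map (ξ 0)) := by
  have := hξ.isProbabilityMeasure_map
  have hmeas : Measurable fun x => truncRpow κ (maxStat p (.dirac PUnit.unit)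
      (kernelFamily N fun i u => t⁻¹ • h i u) m N x) :=
    measurable_truncRpow (measurable_maxStat fun I =>
      measurable_kernelFamily (fun i hi => (hh i hi).const_smul t⁻¹) I)
  rw [← hξ.measurePreserving.lintegral_comp hmeas]
  refine meas_le_lintegral₀ (hmeas.comp hξ.measurePreserving.measurable).aemeasurable
    fun ω hω => ?_
  obtain ⟨n, hn, hlt⟩ : ∃ n ∈ Icc m N, t < ‖uStat h ξ n ω‖ := by
    have hsup : t.toNNReal < (Icc m N).sup fun n => ‖uStat h ξ n ω‖₊ :=
      (Real.toNNReal_lt_iff_lt_coe ht.le).2 hω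
    obtain ⟨n, hn, h⟩ := Finset.lt_sup_iff.1 hsup
    exact ⟨n, hn, (Real.toNNReal_lt_iff_lt_coe ht.le).1 h⟩
  refine (truncRpow_of_one_le ?_).ge
  calc (1 : ℝ≥0∞) ≤ ‖t⁻¹ • uStat h ξ n ω‖ₑ ^ p := by
        refine ENNReal.one_le_rpow ?_ hp
        rw [← ofReal_norm, ENNReal.one_le_ofReal, norm_smul, norm_inv, Real.norm_of_nonneg ht.le,
          inv_mul_eq_div, one_le_div ht]
        exact hlt.le
    _ = pMoment p (.dirac PUnit.unit) fun y => ∑ I ∈ (range n).powersetCard m,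
          kernelFamily N (fun i u => t⁻¹ • h i u) I (fun i => ξ i ω, y) := by
        simp only [sum_kernelFamily (mem_Icc.1 hn).2, ← smul_sum]
        exact (lintegral_dirac PUnit.unit fun _ => ‖t⁻¹ • uStat h ξ n ω‖ₑ ^ p).symm
    _ ≤ _ := pMoment_le_maxStat (mem_Icc.1 hn).2 _

variable [NormedSpace ℝ B] [CompleteSpace B] [BorelSpace B] [SecondCountableTopology B]

theorem IsIID.isDegenerateFamily_kernelFamily_smul {Y : Type*} [MeasurableSpace Y] {ν : Measure Y}
    [IsProbabilityMeasure ν] [IsProbabilityMeasure (P.map (ξ 0))] (hξ : IsIID ξ P)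
    (hh : ∀ i, StrictMono i → Measurable (h i)) (hd : ∀ i, StrictMono i → IsDegenerate (h i) ξ P)
    (hp : 0 < p) (hmoment : ∀ i ∈ inc m N, ∫⁻ ω, ‖h i (firstTerms m ξ ω)‖ₑ ^ p ∂P ≠ ∞) (c : ℝ) :
    IsDegenerateFamily p (P.map (ξ 0)) ν (kernelFamily N fun i u => c • h i u) := by
  refine isDegenerateFamily_kernelFamily hp (fun i hi => (hh i hi).const_smul c)
    (fun i hi => ?_) fun i hi l => ?_
  · have hc : ‖c‖ₑ ^ p ≠ ∞ := ENNReal.rpow_ne_top_of_nonneg hp.le enorm_ne_top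
    simp only [pMoment, enorm_smul, ENNReal.mul_rpow_of_nonneg _ _ hp.le,
      lintegral_const_mul' _ _ hc]
    exact ENNReal.mul_ne_top hc ((hξ.pMoment_eq (hh i (mem_inc.1 hi).2)).trans_ne (hmoment i hi))
  · filter_upwards [(hd i hi).ae_integral_update_eq_zero hξ (hh i hi).stronglyMeasurable l]
      with u hu
    rw [integral_smul, hu, smul_zero]

/-- The constant in the bound for the tails of `U`-statistics, where `κ = q / p`. -/
noncomputable def tailConst (p : ℝ) (C : ℝ≥0) (κ : ℝ) (m : ℕ) : ℝ≥0 :=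
  (2 * maximalConst p C κ) ^ m * (2 ^ m) ^ κ

theorem measure_lt_sup_uStat_le {ψ : Seminorm ℝ B} {C : ℝ≥0} (hψ : IsTwoPointNorm p ψ C)
    (hp : 1 ≤ p) (hq : 0 < q) (ht : 0 < t) (hξ : IsIID ξ P)
    (hh : ∀ i, StrictMono i → Measurable (h i)) (hd : ∀ i, StrictMono i → IsDegenerate (h i) ξ P)
    (hmoment : ∀ i ∈ inc m N, ∫⁻ ω, ‖h i (firstTerms m ξ ω)‖ₑ ^ p ∂P ≠ ∞) :
    P {ω | t < (((Icc m N).sup fun n => ‖uStat h ξ n ω‖₊ : ℝ≥0) : ℝ)} ≤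
      tailConst p C (q / p) m * (ENNReal.ofReal q * ∑ J : Finset (Fin m), ∑ a ∈ placements N J,
        tailIntegral P q t (condMomentRoot P h ξ p N J a)) := by
  have := hξ.isProbabilityMeasure_map
  have hp0 : 0 < p := zero_lt_one.trans_le hp
  have hκ : 0 < q / p := div_pos hq hp0
  refine (measure_lt_sup_uStat_le_lintegral hξ hh hp0 ht (q / p) N).trans ?_
  refine ((hξ.isDegenerateFamily_kernelFamily_smul hh hd hp0 hmoment
    t⁻¹).lintegral_truncRpow_maxStat_le hψ hp hκ m N).trans ?_
  refine (mul_le_mul_right (sum_lintegral_truncRpow_condMomentSum_kernelFamily_le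
    (h := fun i u => t⁻¹ • h i u) (fun i hi => (hh i hi).const_smul t⁻¹) hκ) _).trans_eq ?_
  simp only [hξ.lintegral_truncRpow_kernelMomentSum_smul hh hp0 hq ht, ← mul_sum]
  rw [← mul_assoc, tailConst, ENNReal.coe_mul, ENNReal.coe_rpow_of_nonneg _ hκ.le]
  norm_num

end Tails

end UStat

theorem theorem1
    (B : Type w) [NormedAddCommGroup B] [NormedSpace ℝ B] [CompleteSpace B]
    [TopologicalSpace.SeparableSpace B] [MeasurableSpace B] [BorelSpace B]
    (m : ℕ) (hm : 1 ≤ m) (r : ℝ) (hr : r ∈ Set.Ioc (1 : ℝ) 2) (hB : UStat.IsSmoothSpace r B)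
    (p : ℝ) (hp : p ∈ Set.Ioc 1 r) (q : ℝ) (hq : 0 < q) :
    ∃ K : ℝ≥0,
      ∀ (Ω : Type u) [MeasurableSpace Ω] (P : Measure Ω) [IsProbabilityMeasure P]
        (S : Type v) [MeasurableSpace S] (ξ : ℕ → Ω → S) (_ : UStat.IsIID ξ P)
        (h : (Fin m → ℕ) → (Fin m → S) → B)
        (_ : ∀ i, StrictMono i → Measurable (h i))
        (_ : ∀ i, StrictMono i → UStat.IsDegenerate (h i) ξ P)
        (N : ℕ) (t : ℝ) (_ : 0 < t),
        P {ω | t < (((Finset.Icc m N).sup fun n => ‖UStat.uStat h ξ n ω‖₊ : ℝ≥0) : ℝ)} ≤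
          K * ∑ i ∈ UStat.inc m N,
              UStat.tailIntegral P q t (fun ω => ‖h i (UStat.firstTerms m ξ ω)‖ₑ)
          + K * ∑ J : Finset (Fin m) with J.Nonempty ∧ J ≠ Finset.univ, ∑' a : J → ℕ,
              UStat.tailIntegral P q t (UStat.condMomentRoot P h ξ p N J a)
          + K * (ENNReal.ofReal t ^ (-q) *
              (∑ i ∈ UStat.inc m N, ∫⁻ ω, ‖h i (UStat.firstTerms m ξ ω)‖ₑ ^ p ∂P) ^ (q / p)) := by
  have : SecondCountableTopology B := UniformSpace.secondCountable_of_separable B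
  have : Nonempty (Fin m) := ⟨⟨0, hm⟩⟩
  have hp0 : 0 < p := zero_lt_one.trans hp.1
  obtain ⟨ψ, C, hψ⟩ := hB.exists_isTwoPointNorm hr.2 hp
  set D := UStat.tailConst p C (q / p) m
  refine ⟨1 + D + D * q.toNNReal, fun Ω _ P _ S _ ξ hξ h hh hd N t ht => ?_⟩
  set K : ℝ≥0 := 1 + D + D * q.toNNReal
  by_cases hmoment : ∀ i ∈ UStat.inc m N, ∫⁻ ω, ‖h i (UStat.firstTerms m ξ ω)‖ₑ ^ p ∂P ≠ ∞
  · have hD : (D : ℝ≥0∞) ≤ K := ENNReal.coe_le_coe.2 (le_add_self.trans le_self_add)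
    have hDq : D * ENNReal.ofReal q ≤ K := ENNReal.coe_le_coe.2 le_add_self
    refine (UStat.measure_lt_sup_uStat_le hψ hp.1.le hq ht hξ hh hd hmoment).trans ?_
    rw [UStat.sum_finset_eq_univ_add_proper_add_empty,
      UStat.sum_tailIntegral_condMomentRoot_univ hξ hh hp0, mul_add, mul_add, mul_add, mul_add,
      ← mul_assoc, ← mul_assoc]
    refine add_le_add (add_le_add (by gcongr) ?_) (mul_le_mul' hD ?_)
    · gcongr
      exact ENNReal.sum_le_tsum _
    · exact UStat.sum_tailIntegral_condMomentRoot_empty_le hξ hh hq ht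
  · push Not at hmoment
    have hK : (K : ℝ≥0∞) ≠ 0 := by positivity
    have ht0 : ENNReal.ofReal t ^ (-q) ≠ 0 := by simp [hq.le]
    rw [ENNReal.sum_eq_top.2 hmoment, ENNReal.top_rpow_of_pos (div_pos hq hp0),
      ENNReal.mul_top ht0, ENNReal.mul_top hK, add_top]
    exact le_top
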